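/- An MV-algebra is a structure $(M,\oplus,\neg,0)$ such that $(M,\oplus,0)$ is a commutative monoid, $\neg\neg a=a$, $a\oplus\neg 0=\neg 0$ and $\neg(\neg a\oplus b)\oplus b=\neg(\neg b\oplus a)\oplus a$; put $1=\neg 0$, $a\odot b=\neg(\neg a\oplus\neg b)$, $a\wedge b=a\odot(\neg a\oplus b)$, and $a\le b$ iff $\neg a\oplus b=1$. A unital Abelian $\ell$-group is a lattice-ordered Abelian group $G$ with an element $1\ge 0$ such that every $g\in G$ satisfies $g\le n\cdot 1$ for some $n\in\mathbb N$; unital $\ell$-homomorphisms are the group homomorphisms preserving $\vee$, $\wedge$ and $1$. A state $s\colon G\to H$ of unital Abelian $\ell$-groups is a group homomorphism with $s(1)=1$ and $s(g)\ge 0$ for all $g\ge 0$. Let $\mathsf{ES}$ be the category whose objects are the two-sorted algebras $(M,N)$ consisting of MV-algebras $M$, $N$ and an operation $s\colon M\to N$ such that, for all $a,b\in M$, (A1) $s(a\oplus b)=s(a)\oplus s(b\wedge\neg a)$, (A2) $s(\neg a)=\neg s(a)$, (A3) $s(1)=1$, and whose morphisms $(M_1,N_1)\to(M_2,N_2)$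 are the pairs $(m,n)$ of MV-homomorphisms $m\colon M_1\to M_2$, $n\colon N_1\to N_2$ with $n\circ s=s\circ m$. Let $\mathsf{SS}$ be the category whose objects are the states $G\to H$ of unital Abelian $\ell$-groups and whose morphisms are the pairs of unital $\ell$-homomorphisms $G_1\to G_2$, $H_1\to H_2$ making the evident square commute. For a unital Abelian $\ell$-group $G$ let $\Gamma G=\{a\in G\mid 0\le a\le 1\}$ be the MV-algebra with $a\oplus b=(a+b)\wedge 1$ and $\neg a=1-a$, and let $\Gamma g$ be the restriction of a unital $\ell$-homomorphism $g$. The functor $\Gamma^2\colon\mathsf{SS}\to\mathsf{ES}$ sends a state $G\to H$ to $(\Gamma G,\Gamma H)$ with $s$ the restriction of the state, and $(g,h)$ to $(\Gamma g,\Gamma h)$. For an MV-algebra $M$, a good sequence is a sequence $(a_i)_{i\ge 1}$ in $M$ with $a_i\oplus a_{i+1}=a_i$ for all $i$ and $a_i=0$ for all large $i$; write $(a)$ for $(a,0,0,\dots)$. Good sequences form a cancellative commutative monoid $A_M$ under $(\mathbf a+\mathbf b)_i=a_i\oplus(a_{i-1}\odot b_1)\oplus\dots\oplus(a_1\odot b_{i-1})\oplus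 b_i$. The group $\Xi M$ is the group of differences of $A_M$: classes $[\mathbf a,\mathbf b]$ of pairs, where $[\mathbf a,\mathbf b]=[\mathbf a',\mathbf b']$ iff $\mathbf a+\mathbf b'=\mathbf a'+\mathbf b$; it is a unital Abelian $\ell$-group under the translation-invariant order extending the pointwise order of $A_M$, with unit $[(1),(0)]$. For an MV-homomorphism $h\colon M\to N$, $\Xi h\colon\Xi M\to\Xi N$ is the unital $\ell$-homomorphism $[(a_i),(b_i)]\mapsto[(h(a_i)),(h(b_i))]$. For an object $(M,N)$ of $\mathsf{ES}$, $\Xi s\colon\Xi M\to\Xi N$ is the unique state with $\Xi s([(a),(0)])=[(s(a)),(0)]$ for all $a\in M$. The functor $\Xi^2\colon\mathsf{ES}\to\mathsf{SS}$ sends $(M,N)$ to the state $\Xi s\colon\Xi M\to\Xi N$ and $(m,n)$ to $(\Xi m,\Xi n)$. **Theorem.** The functors $\Gamma^2\colon\mathsf{SS}\to\mathsf{ES}$ and $\Xi^2\colon\mathsf{ES}\to\mathsf{SS}$ form an equivalence of categories. -/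

import Mathlib

/-!
# States as two-sorted algebras and states of unital Abelian ℓ-groups

The objects of the theorem: MV-algebras (`MVAlgebra`), good sequences (`GoodSeq`), the group `Ξ M`
(`XiGroup`, `Xi`), unital Abelian ℓ-groups (`UnitalLGroup`), the unit interval (`Gam`), states
(`ES`, `LState`, `SS`) and the functors `Gamma2` and `Xi2`.

That good sequences form a cancellative commutative monoid and that `Ξ M` is an ℓ-group is part of
the definition of `Xi2`, and is proved here through representations of MV-algebras in totally
ordered Abelian groups (`ChainRep`).
-/

universe u

/-- MV-algebras, in the signature `(⊕, ¬, 0)`. -/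
class MVAlgebra (M : Type u) where
  oplus : M → M → M
  neg : M → M
  zero : M
  oplus_assoc : ∀ a b c : M, oplus (oplus a b) c = oplus a (oplus b c)
  oplus_comm : ∀ a b : M, oplus a b = oplus b a
  oplus_zero : ∀ a : M, oplus a zero = a
  neg_neg : ∀ a : M, neg (neg a) = a
  oplus_neg_zero : ∀ a : M, oplus a (neg zero) = neg zero
  lukasiewicz : ∀ a b : M,
    oplus (neg (oplus (neg a) b)) b = oplus (neg (oplus (neg b) a)) a

namespace MVAlgebra

infixl:65 " ⊕ₘ " => MVAlgebra.oplus
prefix:max "¬ₘ" => MVAlgebra.neg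

variable {M : Type u} [MVAlgebra M]

/-- The constant `1 = ¬0`. -/
def one : M := ¬ₘ zero

/-- `a ⊙ b = ¬(¬a ⊕ ¬b)`. -/
def odot (a b : M) : M := ¬ₘ (¬ₘ a ⊕ₘ ¬ₘ b)

infixl:70 " ⊙ₘ " => MVAlgebra.odot

/-- `a ∧ b = a ⊙ (¬a ⊕ b)`. -/
def inf (a b : M) : M := a ⊙ₘ (¬ₘ a ⊕ₘ b)

/-- `a ∨ b = (a ⊙ ¬b) ⊕ b`. -/
def sup (a b : M) : M := (a ⊙ₘ ¬ₘ b) ⊕ₘ b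

/-- The natural order: `a ≤ b` iff `¬a ⊕ b = 1`. -/
def le (a b : M) : Prop := ¬ₘ a ⊕ₘ b = one

/-! ### Elementary arithmetic -/

instance : Std.Associative (α := M) oplus := ⟨oplus_assoc⟩
instance : Std.Commutative (α := M) oplus := ⟨oplus_comm⟩

theorem zero_oplus (a : M) : zero ⊕ₘ a = a := by rw [oplus_comm, oplus_zero]

theorem oplus_one (a : M) : a ⊕ₘ one = one := oplus_neg_zero a

theorem neg_one : ¬ₘ (one : M) = zero := neg_neg _

theorem neg_zero : ¬ₘ (zero : M) = one := rfl

theorem oplus_neg (a : M) : a ⊕ₘ ¬ₘ a = one := by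
  have h := lukasiewicz a (one : M)
  rw [neg_one, zero_oplus, oplus_one, oplus_comm] at h
  exact h.symm

theorem le_refl (a : M) : le a a := by rw [le, oplus_comm, oplus_neg]

theorem sup_comm (a b : M) : sup a b = sup b a := by
  simp only [sup, odot, neg_neg]; exact lukasiewicz a b

theorem le_iff_exists {a b : M} : le a b ↔ ∃ c, a ⊕ₘ c = b := by
  constructor
  · intro h
    refine ⟨b ⊙ₘ ¬ₘ a, ?_⟩
    have h2 := sup_comm a b
    simp only [sup, odot, neg_neg] at h2
    rw [le] at h
    rw [h, neg_one, zero_oplus] at h2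
    simp only [odot, neg_neg]
    rw [oplus_comm, ← h2]
  · rintro ⟨c, rfl⟩
    rw [le, ← oplus_assoc, oplus_comm (¬ₘ a), oplus_neg, oplus_comm, oplus_one]

theorem le_trans {a b c : M} (h : le a b) (h' : le b c) : le a c := by
  rw [le_iff_exists] at *
  obtain ⟨x, rfl⟩ := h
  obtain ⟨y, rfl⟩ := h'
  exact ⟨x ⊕ₘ y, (oplus_assoc _ _ _).symm⟩

theorem le_antisymm {a b : M} (h : le a b) (h' : le b a) : a = b := by
  have h2 := sup_comm a b
  simp only [sup, odot, neg_neg] at h2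
  rw [le] at h h'
  rw [h, h', neg_one, zero_oplus, zero_oplus] at h2
  exact h2.symm

theorem zero_le (a : M) : le zero a := le_iff_exists.2 ⟨a, zero_oplus a⟩

theorem le_one (a : M) : le a one := by rw [le, oplus_one]

theorem le_zero {a : M} (h : le a zero) : a = zero := le_antisymm h (zero_le a)

theorem one_le {a : M} (h : le one a) : a = one := le_antisymm (le_one a) h

theorem oplus_le {a b c d : M} (h : le a b) (h' : le c d) : le (a ⊕ₘ c) (b ⊕ₘ d) := by
  rw [le_iff_exists] at *
  obtain ⟨x, rfl⟩ := h
  obtain ⟨y, rfl⟩ := h'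
  exact ⟨x ⊕ₘ y, by ac_rfl⟩

theorem neg_le {a b : M} (h : le a b) : le (¬ₘ b) (¬ₘ a) := by
  rw [le] at *
  rwa [neg_neg, oplus_comm]

theorem odot_comm (a b : M) : a ⊙ₘ b = b ⊙ₘ a := by rw [odot, odot, oplus_comm]

theorem odot_assoc (a b c : M) : a ⊙ₘ b ⊙ₘ c = a ⊙ₘ (b ⊙ₘ c) := by
  simp only [odot, neg_neg, oplus_assoc]

instance : Std.Associative (α := M) odot := ⟨odot_assoc⟩
instance : Std.Commutative (α := M) odot := ⟨odot_comm⟩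

theorem odot_one (a : M) : a ⊙ₘ one = a := by rw [odot, neg_one, oplus_zero, neg_neg]

theorem odot_zero (a : M) : a ⊙ₘ zero = zero := by
  rw [odot, neg_zero, oplus_one, neg_one]

theorem odot_neg (a : M) : a ⊙ₘ ¬ₘ a = zero := by
  rw [odot, neg_neg, oplus_comm, oplus_neg, neg_one]

theorem odot_le {a b c d : M} (h : le a b) (h' : le c d) : le (a ⊙ₘ c) (b ⊙ₘ d) :=
  neg_le (oplus_le (neg_le h) (neg_le h'))

theorem odot_le_left (a b : M) : le (a ⊙ₘ b) a := by
  have := odot_le (le_refl a) (le_one b)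
  rwa [odot_one] at this

theorem odot_le_right (a b : M) : le (a ⊙ₘ b) b := by
  rw [odot_comm]; exact odot_le_left b a

theorem le_oplus_left (a b : M) : le a (a ⊕ₘ b) := le_iff_exists.2 ⟨b, rfl⟩

/-- Residuation: `a ⊙ ¬b ≤ c` iff `a ≤ b ⊕ c`. -/
theorem sub_le_iff {a b c : M} : le (a ⊙ₘ ¬ₘ b) c ↔ le a (b ⊕ₘ c) := by
  simp only [le, odot, neg_neg, oplus_assoc]

theorem le_iff_sub {a b : M} : le a b ↔ a ⊙ₘ ¬ₘ b = zero := by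
  constructor
  · intro h
    apply le_zero
    rwa [sub_le_iff, oplus_zero]
  · intro h
    have := sub_le_iff (a := a) (b := b) (c := zero)
    rw [h, oplus_zero] at this
    exact this.1 (le_refl _)

theorem odot_eq_zero_iff {a b : M} : a ⊙ₘ b = zero ↔ le a (¬ₘ b) := by
  rw [le_iff_sub, neg_neg]

theorem oplus_eq_one_iff {a b : M} : a ⊕ₘ b = one ↔ le (¬ₘ a) b := by
  rw [le, neg_neg]

theorem sup_eq {a b : M} (h : le a b) : (b ⊙ₘ ¬ₘ a) ⊕ₘ a = b := by
  have := sup_comm a b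
  rw [sup, le_iff_sub.1 h, zero_oplus] at this
  exact this.symm

theorem inf_eq_neg_sup (a b : M) : inf a b = ¬ₘ (sup (¬ₘ b) (¬ₘ a)) := by
  simp only [inf, sup, odot, neg_neg]
  rw [oplus_comm, oplus_comm b]

theorem inf_comm (a b : M) : inf a b = inf b a := by
  rw [inf_eq_neg_sup, inf_eq_neg_sup, sup_comm]

theorem inf_le_left (a b : M) : le (inf a b) a := odot_le_left _ _

theorem inf_le_right (a b : M) : le (inf a b) b := by rw [inf_comm]; exact inf_le_left _ _

theorem sup_le {a b c : M} (h : le a c) (h' : le b c) : le (sup a b) c := by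
  have := oplus_le (odot_le h (le_refl (¬ₘ b))) (le_refl b)
  rwa [sup_eq h'] at this

theorem le_inf {a b c : M} (h : le c a) (h' : le c b) : le c (inf a b) := by
  rw [inf_eq_neg_sup, ← neg_neg c]
  exact neg_le (sup_le (neg_le h') (neg_le h))

theorem prelinear (a b : M) : inf (a ⊙ₘ ¬ₘ b) (b ⊙ₘ ¬ₘ a) = zero := by
  set y := b ⊙ₘ ¬ₘ a with hy
  have e1 : inf (a ⊙ₘ ¬ₘ b) y = ¬ₘ b ⊙ₘ inf a (b ⊕ₘ y) := by
    have : ¬ₘ (a ⊙ₘ ¬ₘ b) ⊕ₘ y = ¬ₘ a ⊕ₘ (b ⊕ₘ y) := by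
      simp only [odot, neg_neg, oplus_assoc]
    rw [inf, inf, this]; ac_rfl
  have e2 : ¬ₘ b ⊙ₘ inf a (b ⊕ₘ y) = inf y (¬ₘ b) ⊙ₘ (¬ₘ (b ⊕ₘ y) ⊕ₘ a) := by
    rw [inf_comm a, inf_comm y]
    simp only [inf, neg_neg]; ac_rfl
  have e3 : ¬ₘ (b ⊕ₘ y) = ¬ₘ b ⊙ₘ ¬ₘ y := by simp only [odot, neg_neg]
  have e4 : inf y (¬ₘ b) ⊙ₘ (¬ₘ (b ⊕ₘ y) ⊕ₘ a)
      = b ⊙ₘ inf (¬ₘ a) (¬ₘ b ⊙ₘ ¬ₘ y) ⊙ₘ (¬ₘ y ⊕ₘ ¬ₘ b) := by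
    rw [e3]; simp only [inf, neg_neg]
    rw [oplus_comm a]
    rw [show y ⊙ₘ (¬ₘ y ⊕ₘ ¬ₘ b) = (b ⊙ₘ ¬ₘ a) ⊙ₘ (¬ₘ y ⊕ₘ ¬ₘ b) by rw [← hy]]
    ac_rfl
  rw [e1, e2, e4]
  apply le_zero
  refine le_trans (odot_le_left _ _) (le_trans (odot_le (le_refl b)
    (le_trans (inf_le_right _ _) (odot_le_left _ _))) ?_)
  rw [odot_neg]; exact le_refl _

theorem oplus_odot_assoc {a b c : M} (h : a ⊙ₘ b = zero) (h' : b ⊙ₘ c = zero) :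
    (a ⊕ₘ b) ⊙ₘ c = a ⊙ₘ (b ⊕ₘ c) := by
  have hbc : le b (¬ₘ c) := odot_eq_zero_iff.1 h'
  have key : ∀ z, le ((a ⊕ₘ b) ⊙ₘ c) z ↔ le (a ⊙ₘ (b ⊕ₘ c)) z := by
    intro z
    have e1 : (a ⊕ₘ b) ⊙ₘ c = (a ⊕ₘ b) ⊙ₘ ¬ₘ (¬ₘ c) := by rw [neg_neg]
    have e2 : a ⊙ₘ (b ⊕ₘ c) = a ⊙ₘ ¬ₘ (¬ₘ c ⊙ₘ ¬ₘ b) := by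
      simp only [odot, neg_neg, oplus_comm]
    have e3 : (¬ₘ c ⊙ₘ ¬ₘ b) ⊕ₘ b = ¬ₘ c := sup_eq hbc
    rw [e1, e2, sub_le_iff, sub_le_iff]
    constructor
    · intro hz
      have : le ((a ⊕ₘ b) ⊙ₘ ¬ₘ b) ((¬ₘ c ⊙ₘ ¬ₘ b) ⊕ₘ z) := by
        rw [sub_le_iff, ← oplus_assoc, oplus_comm b, e3]; exact hz
      refine le_trans ?_ this
      have e4 : (a ⊕ₘ b) ⊙ₘ ¬ₘ b = inf (¬ₘ b) a := by
        rw [inf, neg_neg]; simp only [odot_comm, oplus_comm]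
      rw [e4]
      exact le_inf (odot_eq_zero_iff.1 h) (le_refl a)
    · intro hz
      have := oplus_le hz (le_refl b)
      rwa [oplus_assoc, oplus_comm z b, ← oplus_assoc, e3] at this
  exact le_antisymm ((key _).2 (le_refl _)) ((key _).1 (le_refl _))

theorem odot_oplus_assoc {a b c : M} (h : a ⊕ₘ b = one) (h' : b ⊕ₘ c = one) :
    (a ⊙ₘ b) ⊕ₘ c = a ⊕ₘ (b ⊙ₘ c) := by
  have h1 : ¬ₘ a ⊙ₘ ¬ₘ b = zero := by rw [odot, neg_neg, neg_neg, h, neg_one]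
  have h2 : ¬ₘ b ⊙ₘ ¬ₘ c = zero := by rw [odot, neg_neg, neg_neg, h', neg_one]
  have := congrArg neg (oplus_odot_assoc h1 h2)
  simpa only [odot, neg_neg] using this

theorem odot_oplus_assoc' {a b c : M} (h : a ⊕ₘ b = one) (h' : b ⊙ₘ c = zero) :
    (a ⊙ₘ b) ⊕ₘ c = a ⊙ₘ (b ⊕ₘ c) := by
  have hab : le (¬ₘ a) b := oplus_eq_one_iff.1 h
  have hba : le (¬ₘ b) a := by rw [← neg_neg a]; exact neg_le hab
  have hcb : le c (¬ₘ b) := odot_eq_zero_iff.1 (by rwa [odot_comm])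
  have e0 : (a ⊙ₘ b) ⊕ₘ ¬ₘ a = b := by
    have := sup_eq hab
    rwa [neg_neg, odot_comm] at this
  have e1 : ((a ⊙ₘ b) ⊕ₘ c) ⊕ₘ ¬ₘ a = b ⊕ₘ c := by
    rw [oplus_assoc, oplus_comm c, ← oplus_assoc, e0]
  have l1 : le ((a ⊙ₘ b) ⊕ₘ c) a := by
    refine le_trans (oplus_le (le_refl _) hcb) ?_
    have := sup_eq hba
    rw [neg_neg] at this
    rw [this]; exact le_refl a
  have e2 : inf a ((a ⊙ₘ b) ⊕ₘ c) = a ⊙ₘ (b ⊕ₘ c) := by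
    rw [inf, oplus_comm (¬ₘ a), e1]
  rw [← e2]
  exact le_antisymm (le_inf l1 (le_refl _)) (inf_le_right _ _)

/-! ### Ideals and linearly ordered quotients -/

/-- Ideals of an MV-algebra. -/
structure IsIdeal (I : Set M) : Prop where
  zero_mem : zero ∈ I
  down : ∀ {a b}, b ∈ I → le a b → a ∈ I
  oplus_mem : ∀ {a b}, a ∈ I → b ∈ I → a ⊕ₘ b ∈ I

/-- MV-chains: nontrivial totally ordered MV-algebras. -/
class MVChain (C : Type u) extends MVAlgebra C where
  total : ∀ a b : C, le a b ∨ le b a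
  zero_ne_one : (zero : C) ≠ one

theorem sub_le_sub_add (a b c : M) : le (a ⊙ₘ ¬ₘ c) ((a ⊙ₘ ¬ₘ b) ⊕ₘ (b ⊙ₘ ¬ₘ c)) := by
  rw [sub_le_iff]
  have h1 : le b (c ⊕ₘ (b ⊙ₘ ¬ₘ c)) := sub_le_iff.1 (le_refl _)
  have h2 : le a (b ⊕ₘ (a ⊙ₘ ¬ₘ b)) := sub_le_iff.1 (le_refl _)
  refine le_trans h2 (le_trans (oplus_le h1 (le_refl _)) ?_)
  rw [oplus_assoc, oplus_comm (b ⊙ₘ ¬ₘ c)]; exact le_refl _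

theorem add_sub_le (a b c d : M) :
    le ((a ⊕ₘ c) ⊙ₘ ¬ₘ (b ⊕ₘ d)) ((a ⊙ₘ ¬ₘ b) ⊕ₘ (c ⊙ₘ ¬ₘ d)) := by
  rw [sub_le_iff]
  have h1 : le a (b ⊕ₘ (a ⊙ₘ ¬ₘ b)) := sub_le_iff.1 (le_refl _)
  have h2 : le c (d ⊕ₘ (c ⊙ₘ ¬ₘ d)) := sub_le_iff.1 (le_refl _)
  refine le_trans (oplus_le h1 h2) ?_
  rw [show b ⊕ₘ (a ⊙ₘ ¬ₘ b) ⊕ₘ (d ⊕ₘ (c ⊙ₘ ¬ₘ d))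
    = b ⊕ₘ d ⊕ₘ ((a ⊙ₘ ¬ₘ b) ⊕ₘ (c ⊙ₘ ¬ₘ d)) by ac_rfl]
  exact le_refl _

theorem neg_sub (a b : M) : ¬ₘ a ⊙ₘ ¬ₘ (¬ₘ b) = b ⊙ₘ ¬ₘ a := by rw [neg_neg, odot_comm]

/-- The congruence of an ideal. -/
def idealSetoid {I : Set M} (hI : IsIdeal I) : Setoid M where
  r a b := a ⊙ₘ ¬ₘ b ∈ I ∧ b ⊙ₘ ¬ₘ a ∈ I
  iseqv :=
    { refl := fun a => by simp only [odot_neg, hI.zero_mem, and_self]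
      symm := fun h => ⟨h.2, h.1⟩
      trans := fun {a b c} h h' =>
        ⟨hI.down (hI.oplus_mem h.1 h'.1) (sub_le_sub_add a b c),
          hI.down (hI.oplus_mem h'.2 h.2) (sub_le_sub_add c b a)⟩ }

/-- The quotient by an ideal. -/
@[reducible] def quotientMV {I : Set M} (hI : IsIdeal I) : MVAlgebra (Quotient (idealSetoid hI)) where
  oplus := Quotient.map₂ oplus fun a b h c d h' =>
    ⟨hI.down (hI.oplus_mem h.1 h'.1) (add_sub_le a b c d),
      hI.down (hI.oplus_mem h.2 h'.2) (add_sub_le b a d c)⟩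
  neg := Quotient.map neg fun a b h => by
    constructor <;> rw [neg_sub]
    exacts [h.2, h.1]
  zero := Quotient.mk _ zero
  oplus_assoc a b c := Quotient.inductionOn₃ a b c fun a b c =>
    congrArg (Quotient.mk _) (oplus_assoc a b c)
  oplus_comm a b := Quotient.inductionOn₂ a b fun a b =>
    congrArg (Quotient.mk _) (oplus_comm a b)
  oplus_zero a := Quotient.inductionOn a fun a => congrArg (Quotient.mk _) (oplus_zero a)
  neg_neg a := Quotient.inductionOn a fun a => congrArg (Quotient.mk _) (neg_neg a)
  oplus_neg_zero a := Quotient.inductionOn a fun a =>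
    congrArg (Quotient.mk _) (oplus_neg_zero a)
  lukasiewicz a b := Quotient.inductionOn₂ a b fun a b =>
    congrArg (Quotient.mk _) (lukasiewicz a b)

/-- `n`-fold sum. -/
def nsm (a : M) : ℕ → M
  | 0 => zero
  | n + 1 => nsm a n ⊕ₘ a

theorem nsm_add (a : M) (m n : ℕ) : nsm a (m + n) = nsm a m ⊕ₘ nsm a n := by
  induction n with
  | zero => rw [nsm, oplus_zero]; rfl
  | succ n ih => rw [← add_assoc, nsm, ih, nsm, oplus_assoc]

theorem disj_oplus {u v w : M} (h : inf u v = zero) (h' : inf u w = zero) :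
    inf u (v ⊕ₘ w) = zero := by
  set z := inf u (v ⊕ₘ w) with hz
  have h1 : le z u := inf_le_left _ _
  have h2 : le (z ⊙ₘ ¬ₘ v) w := sub_le_iff.2 (inf_le_right _ _)
  have h3 : z ⊙ₘ ¬ₘ v = zero := le_zero (by
    rw [← h']; exact le_inf (le_trans (odot_le_left _ _) h1) h2)
  apply le_zero
  rw [← h]
  exact le_inf h1 (le_iff_sub.2 h3)

theorem disj_nsm {u v : M} (h : inf u v = zero) (n : ℕ) : inf u (nsm v n) = zero := by
  induction n with
  | zero => exact le_zero (inf_le_right _ _)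
  | succ n ih => exact disj_oplus ih h

theorem disj_nsm_nsm {u v : M} (h : inf u v = zero) (m n : ℕ) :
    inf (nsm u m) (nsm v n) = zero := by
  rw [inf_comm]
  apply disj_nsm
  rw [inf_comm]
  exact disj_nsm h n

theorem le_oplus_inf {x k p q : M} (h : le x (k ⊕ₘ p)) (h' : le x (k ⊕ₘ q)) :
    le x (k ⊕ₘ inf p q) :=
  sub_le_iff.1 (le_inf (sub_le_iff.2 h) (sub_le_iff.2 h'))

theorem isIdeal_adjoin {I : Set M} (hI : IsIdeal I) (c : M) :
    IsIdeal {x | ∃ i ∈ I, ∃ n, le x (i ⊕ₘ nsm c n)} where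
  zero_mem := ⟨zero, hI.zero_mem, 0, zero_le _⟩
  down := fun ⟨i, hi, n, h⟩ h' => ⟨i, hi, n, le_trans h' h⟩
  oplus_mem := by
    rintro a b ⟨i, hi, n, h⟩ ⟨j, hj, m, h'⟩
    refine ⟨i ⊕ₘ j, hI.oplus_mem hi hj, n + m, le_trans (oplus_le h h') ?_⟩
    rw [nsm_add, show i ⊕ₘ nsm c n ⊕ₘ (j ⊕ₘ nsm c m)
      = i ⊕ₘ j ⊕ₘ (nsm c n ⊕ₘ nsm c m) by ac_rfl]
    exact le_refl _

theorem exists_prime {x : M} (hx : x ≠ zero) :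
    ∃ I : Set M, IsIdeal I ∧ x ∉ I ∧ ∀ a b : M, a ⊙ₘ ¬ₘ b ∈ I ∨ b ⊙ₘ ¬ₘ a ∈ I := by
  have h0 : IsIdeal ({zero} : Set M) :=
    { zero_mem := rfl
      down := fun {a b} hb h => by
        rw [Set.mem_singleton_iff] at hb
        subst hb; exact le_zero h
      oplus_mem := fun {a b} ha hb => by
        rw [Set.mem_singleton_iff] at *
        rw [ha, hb, oplus_zero] }
  obtain ⟨I, -, hI⟩ := zorn_subset_nonempty {I : Set M | IsIdeal I ∧ x ∉ I}
    (by
      intro c hc hch ⟨I0, hI0⟩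
      refine ⟨⋃₀ c, ⟨⟨⟨I0, hI0, (hc hI0).1.zero_mem⟩, ?_, ?_⟩, ?_⟩,
        fun s hs => Set.subset_sUnion_of_mem hs⟩
      · rintro a b ⟨J, hJ, hb⟩ h
        exact ⟨J, hJ, (hc hJ).1.down hb h⟩
      · rintro a b ⟨J, hJ, ha⟩ ⟨K, hK, hb⟩
        rcases hch.total hJ hK with h | h
        · exact ⟨K, hK, (hc hK).1.oplus_mem (h ha) hb⟩
        · exact ⟨J, hJ, (hc hJ).1.oplus_mem ha (h hb)⟩
      · rintro ⟨J, hJ, h⟩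
        exact (hc hJ).2 h)
    {zero} ⟨h0, fun h => hx h⟩
  refine ⟨I, hI.prop.1, hI.prop.2, fun a b => ?_⟩
  by_contra! hab
  have key : ∀ c, c ∉ I → ∃ i ∈ I, ∃ n, le x (i ⊕ₘ nsm c n) := by
    intro c hc
    by_contra hcon
    have := hI.le_of_ge ⟨isIdeal_adjoin hI.prop.1 c, hcon⟩
      (fun i hi => ⟨i, hi, 0, le_oplus_left _ _⟩)
    exact hc (this ⟨zero, hI.prop.1.zero_mem, 1, by
      rw [nsm, nsm, zero_oplus, zero_oplus]; exact le_refl _⟩)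
  obtain ⟨i, hi, n, h⟩ := key _ hab.1
  obtain ⟨j, hj, m, h'⟩ := key _ hab.2
  apply hI.prop.2
  have h1 := le_oplus_inf (x := x) (k := i ⊕ₘ j)
    (le_trans h (oplus_le (le_oplus_left i j) (le_refl _)))
    (le_trans h' (oplus_le (by rw [oplus_comm]; exact le_oplus_left j i) (le_refl _)))
  rw [disj_nsm_nsm (prelinear a b), oplus_zero] at h1
  exact hI.prop.1.down (hI.prop.1.oplus_mem hi hj) h1

end MVAlgebra

namespace MVAlgebra
variable {M : Type u} [MVAlgebra M]

/-! ### The ordered group of an MV-chain -/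

/-- Elements `n + c` with `n` an integer and `c < 1` in the chain. -/
@[ext] structure ChainGroup (C : Type u) [MVChain C] where
  n : ℤ
  c : C
  ne_one : c ≠ one

namespace ChainGroup
variable {C : Type u} [MVChain C]

theorem odot_zero_of_ne {a b : C} (h : a ⊕ₘ b ≠ one) : a ⊙ₘ b = zero := by
  rw [odot_eq_zero_iff]
  rcases MVChain.total a (¬ₘ b) with h' | h'
  · exact h'
  · exact absurd (oplus_eq_one_iff.2 h') (by rwa [oplus_comm])

theorem odot_ne_one {a b : C} (h : a ≠ one) : a ⊙ₘ b ≠ one := fun h' =>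
  h (one_le (by rw [← h']; exact odot_le_left a b))

open Classical in
noncomputable instance : Add (ChainGroup C) where
  add x y := if h : x.c ⊕ₘ y.c = one then ⟨x.n + y.n + 1, x.c ⊙ₘ y.c, odot_ne_one x.ne_one⟩
    else ⟨x.n + y.n, x.c ⊕ₘ y.c, h⟩

theorem add_of_one {x y : ChainGroup C} (h : x.c ⊕ₘ y.c = one) :
    x + y = ⟨x.n + y.n + 1, x.c ⊙ₘ y.c, odot_ne_one x.ne_one⟩ := dif_pos h
theorem add_of_ne {x y : ChainGroup C} (h : x.c ⊕ₘ y.c ≠ one) :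
    x + y = ⟨x.n + y.n, x.c ⊕ₘ y.c, h⟩ := dif_neg h
theorem add_n_one {x y : ChainGroup C} (h : x.c ⊕ₘ y.c = one) : (x + y).n = x.n + y.n + 1 := by
  rw [add_of_one h]
theorem add_c_one {x y : ChainGroup C} (h : x.c ⊕ₘ y.c = one) : (x + y).c = x.c ⊙ₘ y.c := by
  rw [add_of_one h]
theorem add_n_ne {x y : ChainGroup C} (h : x.c ⊕ₘ y.c ≠ one) : (x + y).n = x.n + y.n := by
  rw [add_of_ne h]
theorem add_c_ne {x y : ChainGroup C} (h : x.c ⊕ₘ y.c ≠ one) : (x + y).c = x.c ⊕ₘ y.c := by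
  rw [add_of_ne h]

theorem add_comm' (x y : ChainGroup C) : x + y = y + x := by
  by_cases h : x.c ⊕ₘ y.c = one
  · have h' := h
    rw [oplus_comm] at h'
    ext
    · rw [add_n_one h, add_n_one h', add_comm x.n]
    · rw [add_c_one h, add_c_one h', odot_comm]
  · have h' := h
    rw [oplus_comm] at h'
    ext
    · rw [add_n_ne h, add_n_ne h', add_comm x.n]
    · rw [add_c_ne h, add_c_ne h', oplus_comm]

theorem assoc_aux {x y z : ChainGroup C} (h : x.c ⊕ₘ y.c = one) (h' : y.c ⊕ₘ z.c ≠ one) :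
    x + y + z = x + (y + z) := by
  have e := odot_oplus_assoc' h (odot_zero_of_ne h')
  have h1 : (x + y).c ⊕ₘ z.c ≠ one := by
    rw [add_c_one h, e]; exact odot_ne_one x.ne_one
  have h2 : x.c ⊕ₘ (y + z).c = one := by
    rw [add_c_ne h', ← oplus_assoc, h, oplus_comm, oplus_one]
  ext
  · rw [add_n_ne h1, add_n_one h, add_n_one h2, add_n_ne h']; ring
  · rw [add_c_ne h1, add_c_one h, add_c_one h2, add_c_ne h', e]

theorem add_assoc' (x y z : ChainGroup C) : x + y + z = x + (y + z) := by
  by_cases h : x.c ⊕ₘ y.c = one <;> by_cases h' : y.c ⊕ₘ z.c = one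
  · have e := odot_oplus_assoc h h'
    by_cases h1 : (x + y).c ⊕ₘ z.c = one
    · have h2 : x.c ⊕ₘ (y + z).c = one := by
        rw [add_c_one h', ← e, ← add_c_one h, h1]
      ext
      · rw [add_n_one h1, add_n_one h, add_n_one h2, add_n_one h']; ring
      · rw [add_c_one h1, add_c_one h, add_c_one h2, add_c_one h', odot_assoc]
    · have h2 : x.c ⊕ₘ (y + z).c ≠ one := by
        rw [add_c_one h', ← e, ← add_c_one h]; exact h1
      ext
      · rw [add_n_ne h1, add_n_one h, add_n_ne h2, add_n_one h']; ring
      · rw [add_c_ne h1, add_c_one h, add_c_ne h2, add_c_one h', e]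
  · exact assoc_aux h h'
  · have := assoc_aux (x := z) (y := y) (z := x) (by rwa [oplus_comm]) (by rwa [oplus_comm])
    rw [add_comm' x (y + z), add_comm' y z, this, add_comm' (x + y), add_comm' x y]
  · have e := oplus_odot_assoc (odot_zero_of_ne h) (odot_zero_of_ne h')
    by_cases h1 : (x + y).c ⊕ₘ z.c = one
    · have h2 : x.c ⊕ₘ (y + z).c = one := by
        rw [add_c_ne h', ← oplus_assoc, ← add_c_ne h, h1]
      ext
      · rw [add_n_one h1, add_n_ne h, add_n_one h2, add_n_ne h']; ring
      · rw [add_c_one h1, add_c_ne h, add_c_one h2, add_c_ne h', e]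
    · have h2 : x.c ⊕ₘ (y + z).c ≠ one := by
        rw [add_c_ne h', ← oplus_assoc, ← add_c_ne h]; exact h1
      ext
      · rw [add_n_ne h1, add_n_ne h, add_n_ne h2, add_n_ne h']; ring
      · rw [add_c_ne h1, add_c_ne h, add_c_ne h2, add_c_ne h', oplus_assoc]

instance : Zero (ChainGroup C) := ⟨⟨0, zero, MVChain.zero_ne_one⟩⟩

theorem zero_add' (x : ChainGroup C) : 0 + x = x := by
  have h : (0 : ChainGroup C).c ⊕ₘ x.c ≠ one := by
    change zero ⊕ₘ x.c ≠ one
    rw [zero_oplus]; exact x.ne_one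
  ext
  · rw [add_n_ne h]; exact zero_add _
  · rw [add_c_ne h]; exact zero_oplus _

theorem neg_ne_one {a : C} (h : a ≠ zero) : ¬ₘ a ≠ one := fun h' =>
  h (by rw [← neg_neg a, h', neg_one])

open Classical in
noncomputable instance : Neg (ChainGroup C) where
  neg x := if h : x.c = zero then ⟨-x.n, zero, MVChain.zero_ne_one⟩
    else ⟨-x.n - 1, ¬ₘ x.c, neg_ne_one h⟩

theorem neg_add' (x : ChainGroup C) : -x + x = 0 := by
  by_cases h : x.c = zero
  · have e : -x = ⟨-x.n, zero, MVChain.zero_ne_one⟩ := dif_pos h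
    have h1 : (-x).c ⊕ₘ x.c ≠ one := by
      rw [e, h, oplus_zero]; exact MVChain.zero_ne_one
    ext
    · rw [add_n_ne h1, e]; exact neg_add_cancel _
    · rw [add_c_ne h1, e, h, oplus_zero]; rfl
  · have e : -x = ⟨-x.n - 1, ¬ₘ x.c, neg_ne_one h⟩ := dif_neg h
    have h1 : (-x).c ⊕ₘ x.c = one := by
      rw [e, oplus_comm]; exact oplus_neg _
    ext
    · rw [add_n_one h1, e]; change -x.n - 1 + x.n + 1 = 0; ring
    · rw [add_c_one h1, e, odot_comm]; exact odot_neg _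

noncomputable instance : AddCommGroup (ChainGroup C) where
  add_assoc := add_assoc'
  zero_add := zero_add'
  add_zero x := by rw [add_comm', zero_add']
  add_comm := add_comm'
  neg_add_cancel := neg_add'
  nsmul := nsmulRec
  zsmul := zsmulRec

open Classical in
noncomputable instance : LinearOrder (ChainGroup C) where
  le x y := x.n < y.n ∨ x.n = y.n ∧ MVAlgebra.le x.c y.c
  le_refl x := Or.inr ⟨rfl, MVAlgebra.le_refl _⟩
  le_trans x y z := by
    rintro (h | ⟨h, h1⟩) (h' | ⟨h', h2⟩)
    · left; omega
    · left; omega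
    · left; omega
    · exact Or.inr ⟨h.trans h', MVAlgebra.le_trans h1 h2⟩
  le_antisymm x y := by
    rintro (h | ⟨h, h1⟩) (h' | ⟨h', h2⟩)
    · omega
    · omega
    · omega
    · exact ChainGroup.ext h (MVAlgebra.le_antisymm h1 h2)
  le_total x y := by
    rcases lt_trichotomy x.n y.n with h | h | h
    · exact Or.inl (Or.inl h)
    · rcases MVChain.total x.c y.c with h1 | h1
      · exact Or.inl (Or.inr ⟨h, h1⟩)
      · exact Or.inr (Or.inr ⟨h.symm, h1⟩)
    · exact Or.inr (Or.inl h)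
  toDecidableLE := Classical.decRel _

theorem le_def {x y : ChainGroup C} :
    x ≤ y ↔ x.n < y.n ∨ x.n = y.n ∧ MVAlgebra.le x.c y.c := Iff.rfl

instance : IsOrderedAddMonoid (ChainGroup C) where
  add_le_add_left x y hxy z := by
    rw [le_def] at *
    by_cases h : x.c ⊕ₘ z.c = one <;> by_cases h' : y.c ⊕ₘ z.c = one
    · rw [add_n_one h, add_n_one h', add_c_one h, add_c_one h']
      rcases hxy with h1 | ⟨h1, h2⟩
      · left; omega
      · right; exact ⟨by omega, odot_le h2 (MVAlgebra.le_refl _)⟩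
    · rw [add_n_one h, add_n_ne h', add_c_one h, add_c_ne h']
      rcases hxy with h1 | ⟨h1, h2⟩
      · by_cases h3 : x.n + 1 = y.n
        · right
          exact ⟨by omega, MVAlgebra.le_trans (odot_le_right _ _)
            (by rw [oplus_comm]; exact le_oplus_left _ _)⟩
        · left; omega
      · exact absurd (one_le (by rw [← h]; exact oplus_le h2 (MVAlgebra.le_refl _))) h'
    · rw [add_n_ne h, add_n_one h', add_c_ne h, add_c_one h']
      left
      rcases hxy with h1 | ⟨h1, h2⟩ <;> omega
    · rw [add_n_ne h, add_n_ne h', add_c_ne h, add_c_ne h']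
      rcases hxy with h1 | ⟨h1, h2⟩
      · left; omega
      · right; exact ⟨by omega, oplus_le h2 (MVAlgebra.le_refl _)⟩

variable (C) in
/-- The unit of the group. -/
def unit : ChainGroup C := ⟨1, zero, MVChain.zero_ne_one⟩

open Classical in
/-- The inclusion of the chain in its group. -/
noncomputable def incl (a : C) : ChainGroup C := if h : a = one then unit C else ⟨0, a, h⟩

theorem incl_one : incl (one : C) = unit C := dif_pos rfl

theorem incl_ne {a : C} (h : a ≠ one) : incl a = ⟨0, a, h⟩ := dif_neg h

theorem incl_nonneg (a : C) : 0 ≤ incl a := by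
  by_cases h : a = one
  · rw [h, incl_one]; exact Or.inl one_pos
  · rw [incl_ne h]; exact Or.inr ⟨rfl, zero_le _⟩

theorem incl_oplus (a b : C) : incl (a ⊕ₘ b) = min (incl a + incl b) (unit C) := by
  by_cases ha : a = one
  · rw [ha, oplus_comm, oplus_one, incl_one, min_eq_right]
    exact le_add_of_nonneg_right (incl_nonneg b)
  by_cases hb : b = one
  · rw [hb, oplus_one, incl_one, min_eq_right]
    exact le_add_of_nonneg_left (incl_nonneg a)
  by_cases h : a ⊕ₘ b = one
  · rw [h, incl_one, min_eq_right]
    have h' : (incl a).c ⊕ₘ (incl b).c = one := by rw [incl_ne ha, incl_ne hb]; exact h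
    right
    rw [add_n_one h', incl_ne ha, incl_ne hb]
    exact ⟨rfl, zero_le _⟩
  · have h' : (incl a).c ⊕ₘ (incl b).c ≠ one := by rw [incl_ne ha, incl_ne hb]; exact h
    have e : incl a + incl b = ⟨0, a ⊕ₘ b, h⟩ := by
      ext
      · rw [add_n_ne h', incl_ne ha, incl_ne hb]; rfl
      · rw [add_c_ne h', incl_ne ha, incl_ne hb]
    rw [e, incl_ne h, min_eq_left]
    exact Or.inl zero_lt_one

theorem incl_zero : incl (zero : C) = 0 := incl_ne MVChain.zero_ne_one

theorem incl_neg (a : C) : incl (¬ₘ a) = unit C - incl a := by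
  rw [eq_sub_iff_add_eq]
  by_cases ha : a = one
  · rw [ha, neg_one, incl_one, incl_zero, zero_add]
  by_cases h0 : a = zero
  · rw [h0, incl_zero, neg_zero, incl_one, add_zero]
  have hn := neg_ne_one h0
  have h : (incl (¬ₘ a)).c ⊕ₘ (incl a).c = one := by
    rw [incl_ne hn, incl_ne ha, oplus_comm]; exact oplus_neg a
  ext
  · rw [add_n_one h, incl_ne hn, incl_ne ha]; rfl
  · rw [add_c_one h, incl_ne hn, incl_ne ha, odot_comm]; exact odot_neg a

theorem incl_eq_zero {a : C} (h : incl a = 0) : a = zero := by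
  by_cases ha : a = one
  · rw [ha, incl_one] at h
    exact absurd (congrArg ChainGroup.n h) one_ne_zero
  · rw [incl_ne ha] at h
    exact congrArg ChainGroup.c h

end ChainGroup

/-- A representation of an MV-algebra in the unit interval of a totally ordered Abelian group. -/
structure ChainRep (M : Type u) [MVAlgebra M] where
  C : Type u
  [grp : AddCommGroup C]
  [ord : LinearOrder C]
  [ordered : IsOrderedAddMonoid C]
  e : C
  v : M → C
  nonneg : ∀ a, 0 ≤ v a
  v_zero : v zero = 0
  v_oplus : ∀ a b, v (a ⊕ₘ b) = min (v a + v b) e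
  v_neg : ∀ a, v (¬ₘ a) = e - v a

attribute [instance] ChainRep.grp ChainRep.ord ChainRep.ordered

theorem exists_rep {x : M} (hx : x ≠ zero) : ∃ r : ChainRep M, r.v x ≠ 0 := by
  obtain ⟨I, hI, hxI, htot⟩ := exists_prime hx
  let q : M → Quotient (idealSetoid hI) := Quotient.mk _
  have hq : ∀ {a : M}, q a = q zero → a ∈ I := by
    intro a h
    have := (Quotient.exact h).1
    rwa [neg_zero, odot_one] at this
  let _ := quotientMV hI
  let _ : MVChain (Quotient (idealSetoid hI)) :=
    { quotientMV hI with
      total := fun a b => Quotient.inductionOn₂ a b fun a b => by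
        rw [le_iff_sub, le_iff_sub]
        have key : ∀ c : M, c ∈ I → q c = q zero := fun c hc => Quotient.sound
          ⟨by rwa [neg_zero, odot_one], by rw [odot_comm, odot_zero]; exact hI.zero_mem⟩
        exact (htot a b).imp (key _) (key _)
      zero_ne_one := fun h => hxI (by
        have : (one : M) ∈ I := hq h.symm
        exact hI.down this (le_one x)) }
  exact ⟨{
    C := ChainGroup (Quotient (idealSetoid hI))
    e := ChainGroup.unit _
    v := fun a => ChainGroup.incl (q a)
    nonneg := fun a => ChainGroup.incl_nonneg _
    v_zero := ChainGroup.incl_zero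
    v_oplus := fun a b => ChainGroup.incl_oplus (q a) (q b)
    v_neg := fun a => ChainGroup.incl_neg (q a) }, fun h => hxI (hq (ChainGroup.incl_eq_zero h))⟩

namespace ChainRep
variable (r : ChainRep M)

theorem v_one : r.v one = r.e := by rw [one, v_neg, v_zero, sub_zero]

theorem v_le (a : M) : r.v a ≤ r.e := by
  have := r.nonneg (¬ₘ a)
  rwa [v_neg, sub_nonneg] at this

theorem v_odot (a b : M) : r.v (a ⊙ₘ b) = max (r.v a + r.v b - r.e) 0 := by
  have := r.v_le a
  have := r.v_le b
  rw [odot, v_neg, v_oplus, v_neg, v_neg]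
  grind

theorem v_sup (a b : M) : r.v (sup a b) = max (r.v a) (r.v b) := by
  have := r.v_le a
  have := r.v_le b
  have := r.nonneg b
  rw [sup, v_oplus, v_odot, v_neg]
  grind

theorem v_inf (a b : M) : r.v (inf a b) = min (r.v a) (r.v b) := by
  have := r.v_le a
  have := r.nonneg a
  have := r.v_le b
  have := r.nonneg b
  rw [inf, v_odot, v_oplus, v_neg]
  grind

end ChainRep

theorem le_of_rep {a b : M} (h : ∀ r : ChainRep M, r.v a ≤ r.v b) : le a b := by
  rw [le_iff_sub]
  by_contra hx
  obtain ⟨r, hr⟩ := exists_rep hx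
  apply hr
  have := h r
  rw [r.v_odot, r.v_neg]
  grind

theorem rep_le (r : ChainRep M) {a b : M} (h : le a b) : r.v a ≤ r.v b := by
  obtain ⟨c, rfl⟩ := le_iff_exists.1 h
  have := r.v_le a
  have := r.nonneg c
  rw [r.v_oplus]
  grind

theorem eq_of_rep {a b : M} (h : ∀ r : ChainRep M, r.v a = r.v b) : a = b :=
  le_antisymm (le_of_rep fun r => (h r).le) (le_of_rep fun r => (h r).ge)

end MVAlgebra

namespace MVAlgebra
variable {M : Type u} [MVAlgebra M]

/-! ### Good sequences -/

/-- `f 0 ⊕ ⋯ ⊕ f (n - 1)`. -/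
def bigOplus (f : ℕ → M) : ℕ → M
  | 0 => zero
  | n + 1 => bigOplus f n ⊕ₘ f n

/-- The sum of two sequences, indexed from `0`: its term of index `k` is
`a_k ⊕ (a_{k-1} ⊙ b_0) ⊕ ⋯ ⊕ (a_0 ⊙ b_{k-1}) ⊕ b_k`. -/
def seqAdd (a b : ℕ → M) (k : ℕ) : M :=
  a k ⊕ₘ bigOplus (fun j => a (k - 1 - j) ⊙ₘ b j) k ⊕ₘ b k

/-- Good sequences in `M` (indexed from `0`). -/
@[ext] structure GoodSeq (M : Type u) [MVAlgebra M] where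
  seq : ℕ → M
  good : ∀ i, seq i ⊕ₘ seq (i + 1) = seq i
  finite : ∃ n₀, ∀ n, n₀ ≤ n → seq n = zero

namespace ChainRep
variable (r : ChainRep M)

theorem e_nonneg : 0 ≤ r.e := (r.nonneg zero).trans (r.v_le zero)

theorem v_bigOplus (f : ℕ → M) (n : ℕ) :
    r.v (bigOplus f n) = min (∑ j ∈ Finset.range n, r.v (f j)) r.e := by
  induction n with
  | zero => rw [bigOplus, v_zero, Finset.sum_range_zero, min_eq_left r.e_nonneg]
  | succ n ih =>
    have := r.nonneg (f n)
    rw [bigOplus, v_oplus, ih, Finset.sum_range_succ]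
    grind

/-- The term of index `i` of the good sequence of the element `x ≥ 0`. -/
def clip (x : r.C) (i : ℕ) : r.C := max 0 (min r.e (x - i • r.e))

/-- `x` is the sum of the values of the good sequence `a`. -/
structure Val (a : ℕ → M) (x : r.C) : Prop where
  nonneg : 0 ≤ x
  bdd : ∃ n : ℕ, x ≤ n • r.e
  eq : ∀ i, r.v (a i) = r.clip x i

theorem succ_nsmul_le (m n : ℕ) (h : m < n) : m • r.e + r.e ≤ n • r.e := by
  rw [← succ_nsmul]; exact nsmul_le_nsmul_left r.e_nonneg h

theorem clip_split {p : ℕ} {α : r.C} (h0 : 0 ≤ α) (h1 : α ≤ r.e) (i : ℕ) :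
    r.clip (p • r.e + α) i = if i < p then r.e else if i = p then α else 0 := by
  have he := r.e_nonneg
  unfold clip
  split_ifs with h h'
  · have := r.succ_nsmul_le _ _ h
    grind
  · subst h'; grind
  · have := r.succ_nsmul_le p i (by omega)
    grind

theorem exists_split {x : r.C} (h : 0 ≤ x) {n : ℕ} (h' : x ≤ n • r.e) :
    ∃ (p : ℕ) (α : r.C), 0 ≤ α ∧ α ≤ r.e ∧ x = p • r.e + α := by
  induction n with
  | zero => exact ⟨0, 0, le_rfl, r.e_nonneg, by
      rw [zero_nsmul] at h'; rw [zero_nsmul, add_zero]; exact h'.antisymm h⟩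
  | succ n ih =>
    rcases le_total x (n • r.e) with h1 | h1
    · exact ih h1
    · refine ⟨n, x - n • r.e, sub_nonneg.2 h1, ?_, by abel⟩
      rw [succ_nsmul] at h'
      exact sub_le_iff_le_add'.2 h'

theorem exists_val (a : GoodSeq M) : ∃ x, r.Val a.seq x := by
  have he := r.e_nonneg
  rcases he.eq_or_lt with h0 | h0
  · refine ⟨0, le_rfl, ⟨0, by rw [zero_nsmul]⟩, fun i => ?_⟩
    have := r.nonneg (a.seq i)
    have := r.v_le (a.seq i)
    have := nsmul_nonneg he i
    unfold clip
    grind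
  have hex : ∃ i, r.v (a.seq i) ≠ r.e := by
    obtain ⟨n, hn⟩ := a.finite
    exact ⟨n, by rw [hn n le_rfl, v_zero]; exact h0.ne⟩
  classical
  obtain ⟨p, hp, hlt⟩ : ∃ p, r.v (a.seq p) ≠ r.e ∧ ∀ i < p, r.v (a.seq i) = r.e :=
    ⟨Nat.find hex, Nat.find_spec hex, fun i hi => not_not.1 (Nat.find_min hex hi)⟩
  have hgood : ∀ i, r.v (a.seq i) ≠ r.e → r.v (a.seq (i + 1)) = 0 := by
    intro i hi
    have h1 := congrArg r.v (a.good i)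
    have h2 := r.nonneg (a.seq (i + 1))
    have h3 := r.v_le (a.seq i)
    rw [v_oplus] at h1
    grind
  have hz : ∀ j, r.v (a.seq (p + 1 + j)) = 0 := by
    intro j
    induction j with
    | zero => exact hgood p hp
    | succ j ih => exact hgood (p + 1 + j) (by rw [ih]; exact h0.ne)
  have a0 := r.nonneg (a.seq p)
  have a1 := r.v_le (a.seq p)
  refine ⟨p • r.e + r.v (a.seq p), add_nonneg (nsmul_nonneg he p) a0,
    ⟨p + 1, by rw [succ_nsmul]; gcongr⟩, fun i => ?_⟩
  rw [clip_split r a0 a1]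
  split_ifs with h h'
  · exact hlt i h
  · rw [h']
  · have := hz (i - (p + 1))
    rwa [show p + 1 + (i - (p + 1)) = i by omega] at this

variable {r}

theorem Val.le_of {a b : ℕ → M} {x y : r.C} (ha : r.Val a x) (hb : r.Val b y)
    (h : ∀ i, r.v (a i) ≤ r.v (b i)) : x ≤ y := by
  have he := r.e_nonneg
  obtain ⟨n, hn⟩ := ha.bdd
  obtain ⟨p, α, h0, h1, rfl⟩ := r.exists_split ha.nonneg hn
  obtain ⟨m, hm⟩ := hb.bdd
  obtain ⟨q, β, k0, k1, rfl⟩ := r.exists_split hb.nonneg hm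
  have key : ∀ i, r.clip (p • r.e + α) i ≤ r.clip (q • r.e + β) i := fun i => by
    rw [← ha.eq, ← hb.eq]; exact h i
  simp only [clip_split r h0 h1, clip_split r k0 k1] at key
  rcases lt_trichotomy p q with hpq | rfl | hpq
  · have := r.succ_nsmul_le p q hpq
    grind
  · have := key p
    simp only [lt_irrefl, if_false, if_true] at this
    gcongr
  · have l1 := key p
    have l2 := key q
    have l3 := key (q + 1)
    have e1 : ¬ (p < q) := by omega
    have e2 : ¬ (p = q) := by omega
    simp only [lt_irrefl, if_false, if_true, e1, e2, hpq] at l1 l2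
    rcases Nat.lt_or_ge (q + 1) p with hp | hp
    · have e3 : ¬ (q + 1 < q) := by omega
      have e4 : ¬ (q + 1 = q) := by omega
      simp only [hp, if_true, if_false, e3, e4] at l3
      have e0 : r.e = 0 := l3.antisymm he
      rw [e0] at *
      grind [nsmul_zero]
    · have : p = q + 1 := by omega
      subst this
      rw [succ_nsmul]
      grind

theorem clip_mono {x y : r.C} (h : x ≤ y) (i : ℕ) : r.clip x i ≤ r.clip y i := by
  unfold clip; grind

theorem Val.le_iff {a b : ℕ → M} {x y : r.C} (ha : r.Val a x) (hb : r.Val b y) :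
    x ≤ y ↔ ∀ i, r.v (a i) ≤ r.v (b i) :=
  ⟨fun h i => by rw [ha.eq, hb.eq]; exact clip_mono h i, ha.le_of hb⟩

theorem Val.unique {a : ℕ → M} {x y : r.C} (ha : r.Val a x) (hb : r.Val a y) : x = y :=
  _root_.le_antisymm (ha.le_of hb fun _ => le_rfl) (hb.le_of ha fun _ => le_rfl)

theorem clip_good {x : r.C} (i : ℕ) :
    min (r.clip x i + r.clip x (i + 1)) r.e = r.clip x i := by
  have := r.e_nonneg
  unfold clip
  rw [succ_nsmul]
  grind

/-- The sequence preceded by the unit. -/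
def ext (r : ChainRep M) (a : ℕ → M) : ℕ → r.C
  | 0 => r.e
  | i + 1 => r.v (a i)

theorem v_seqAdd (a b : ℕ → M) (k : ℕ) : r.v (seqAdd a b k) =
    min (∑ j ∈ Finset.range (k + 2), max (r.ext a (k + 1 - j) + r.ext b j - r.e) 0) r.e := by
  have h1 : ∀ j ∈ Finset.range k, max (r.ext a (k + 1 - (j + 1)) + r.ext b (j + 1) - r.e) 0
      = r.v (a (k - 1 - j) ⊙ₘ b j) := by
    intro j hj
    rw [Finset.mem_range] at hj
    rw [v_odot, show k + 1 - (j + 1) = (k - 1 - j) + 1 by omega]; rfl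
  have ha := r.nonneg (a k)
  have hb := r.nonneg (b k)
  rw [Finset.sum_range_succ, Finset.sum_range_succ', Finset.sum_congr rfl h1, seqAdd, v_oplus,
    v_oplus, v_bigOplus, Nat.sub_self, Nat.sub_zero]
  change _ = min (_ + max (r.v (a k) + r.e - r.e) 0 + max (r.e + r.v (b k) - r.e) 0) r.e
  grind

theorem ext_split {a : ℕ → M} {p : ℕ} {α : r.C} (h0 : 0 ≤ α) (h1 : α ≤ r.e)
    (ha : r.Val a (p • r.e + α)) (i : ℕ) :
    r.ext a i = if i < p + 1 then r.e else if i = p + 1 then α else 0 := by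
  cases i with
  | zero => simp [ext]
  | succ i => rw [ext, ha.eq, clip_split r h0 h1]; simp

theorem Val.add {a b : ℕ → M} {x y : r.C} (ha : r.Val a x) (hb : r.Val b y) :
    r.Val (seqAdd a b) (x + y) := by
  have he := r.e_nonneg
  obtain ⟨n, hn⟩ := ha.bdd
  obtain ⟨m, hm⟩ := hb.bdd
  refine ⟨add_nonneg ha.nonneg hb.nonneg, ⟨n + m, by rw [add_nsmul]; gcongr⟩, fun k => ?_⟩
  obtain ⟨p, α, h0, h1, rfl⟩ := r.exists_split ha.nonneg hn
  obtain ⟨q, β, k0, k1, rfl⟩ := r.exists_split hb.nonneg hm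
  rw [v_seqAdd]
  simp only [ext_split h0 h1 ha, ext_split k0 k1 hb]
  have hs : p • r.e + α + (q • r.e + β) = (p + q) • r.e + (α + β) := by rw [add_nsmul]; abel
  rw [hs, clip]
  rcases Nat.lt_trichotomy k (p + q) with hk | hk | hk
  · have e1 : max 0 (min r.e ((p + q) • r.e + (α + β) - k • r.e)) = r.e := by
      have := r.succ_nsmul_le _ _ hk
      grind
    rw [e1, min_eq_right]
    obtain ⟨j, hj, hj1, hj2⟩ : ∃ j ∈ Finset.range (k + 2), k + 1 - j < p + 1 ∧ j < q + 1 :=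
      ⟨min q (k + 1), by rw [Finset.mem_range]; omega, by omega, by omega⟩
    refine _root_.le_trans ?_ (Finset.single_le_sum (fun i _ => le_max_right _ _) hj)
    rw [if_pos hj1, if_pos hj2]
    grind
  · subst hk
    rw [Finset.sum_eq_add (a := q) (b := q + 1) (by omega)]
    · have c2 : p + q + 1 - q = p + 1 := by omega
      have c3 : p + q + 1 - (q + 1) < p + 1 := by omega
      simp only [c2, c3, if_true, if_false, lt_irrefl, Nat.lt_succ_self]
      grind
    · intro j hj hne
      rw [Finset.mem_range] at hj
      rcases Nat.lt_or_ge j q with h | h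
      · have c1 : ¬ (p + q + 1 - j < p + 1) := by omega
        have c2 : ¬ (p + q + 1 - j = p + 1) := by omega
        have c3 : j < q + 1 := by omega
        simp only [c1, c2, c3, if_true, if_false]
        grind
      · have c1 : p + q + 1 - j < p + 1 := by omega
        have c2 : ¬ (j < q + 1) := by omega
        have c3 : ¬ (j = q + 1) := by omega
        simp only [c1, c2, c3, if_true, if_false]
        grind
    · intro h; exact absurd (Finset.mem_range.2 (by omega)) h
    · intro h; exact absurd (Finset.mem_range.2 (by omega)) h
  · rcases Nat.lt_or_ge (p + q + 1) k with hk' | hk'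
    · rw [Finset.sum_eq_zero]
      · have g1 := r.succ_nsmul_le _ _ hk'
        rw [succ_nsmul] at g1
        grind
      · intro j hj
        rw [Finset.mem_range] at hj
        have a0 : (if k + 1 - j < p + 1 then r.e else if k + 1 - j = p + 1 then α else 0) ≤ r.e := by
          split_ifs <;> first | assumption | exact le_rfl
        have b0 : (if j < q + 1 then r.e else if j = q + 1 then β else 0) ≤ r.e := by
          split_ifs <;> first | assumption | exact le_rfl
        rcases Nat.lt_or_ge (q + 1) j with h | h
        · have c2 : ¬ (j < q + 1) := by omega
          have c3 : ¬ (j = q + 1) := by omega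
          rw [if_neg c2, if_neg c3]
          grind
        · have c2 : ¬ (k + 1 - j < p + 1) := by omega
          have c3 : ¬ (k + 1 - j = p + 1) := by omega
          rw [if_neg c2, if_neg c3]
          grind
    · have hk2 : k = p + q + 1 := by omega
      subst hk2
      rw [Finset.sum_eq_single (q + 1)]
      · have c2 : p + q + 1 + 1 - (q + 1) = p + 1 := by omega
        simp only [c2, if_true, if_false, lt_irrefl]
        rw [succ_nsmul]
        grind
      · intro j hj hne
        rw [Finset.mem_range] at hj
        rcases Nat.lt_or_ge j (q + 1) with h | h
        · have c1 : ¬ (p + q + 1 + 1 - j < p + 1) := by omega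
          have c2 : ¬ (p + q + 1 + 1 - j = p + 1) := by omega
          simp only [c1, c2, h, if_true, if_false]
          grind
        · have c1 : p + q + 1 + 1 - j < p + 1 := by omega
          have c2 : ¬ (j < q + 1) := by omega
          simp only [c1, c2, hne, if_true, if_false]
          grind
      · intro h; exact absurd (Finset.mem_range.2 (by omega)) h

end ChainRep

namespace GoodSeq

/-- The sum of the values of a good sequence in a representation. -/
noncomputable def val (r : ChainRep M) (a : GoodSeq M) : r.C := (r.exists_val a).choose

theorem val_spec (r : ChainRep M) (a : GoodSeq M) : r.Val a.seq (val r a) :=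
  (r.exists_val a).choose_spec

theorem val_eq {r : ChainRep M} {a : GoodSeq M} {x : r.C} (h : r.Val a.seq x) : val r a = x :=
  (val_spec r a).unique h

/-- A sequence which is good in every representation is good. -/
theorem good_of_val {a : ℕ → M} (h : ∀ r : ChainRep M, ∃ x, r.Val a x) (i : ℕ) :
    a i ⊕ₘ a (i + 1) = a i :=
  eq_of_rep fun r => by
    obtain ⟨x, hx⟩ := h r
    rw [r.v_oplus, hx.eq, hx.eq, ChainRep.clip_good]

theorem bigOplus_zero {f : ℕ → M} {n : ℕ} (h : ∀ j < n, f j = zero) : bigOplus f n = zero := by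
  induction n with
  | zero => rfl
  | succ n ih => rw [bigOplus, ih fun j hj => h j (by omega), h n (by omega), oplus_zero]

instance : Add (GoodSeq M) where
  add a b :=
    { seq := seqAdd a.seq b.seq
      good := good_of_val fun r => ⟨_, (val_spec r a).add (val_spec r b)⟩
      finite := by
        obtain ⟨n, hn⟩ := a.finite
        obtain ⟨m, hm⟩ := b.finite
        refine ⟨n + m + 1, fun k hk => ?_⟩
        rw [seqAdd, hn k (by omega), hm k (by omega), oplus_zero, zero_oplus]
        refine bigOplus_zero fun j hj => ?_
        rcases Nat.lt_or_ge j m with h | h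
        · rw [hn (k - 1 - j) (by omega), odot_comm, odot_zero]
        · rw [hm j h, odot_zero] }

/-- The good sequence `(a) = (a, 0, 0, …)`. -/
def single (a : M) : GoodSeq M where
  seq i := if i = 0 then a else zero
  good i := by simp [oplus_zero]
  finite := ⟨1, fun n hn => by simp [show n ≠ 0 by omega]⟩

instance : Zero (GoodSeq M) := ⟨single zero⟩

theorem add_seq (a b : GoodSeq M) : (a + b).seq = seqAdd a.seq b.seq := rfl

theorem zero_seq (i : ℕ) : (0 : GoodSeq M).seq i = zero := by
  change (if i = 0 then zero else zero) = zero
  rw [ite_self]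

theorem val_add (r : ChainRep M) (a b : GoodSeq M) : val r (a + b) = val r a + val r b :=
  val_eq ((val_spec r a).add (val_spec r b))

theorem val_single (r : ChainRep M) (a : M) : val r (single a) = r.v a := by
  refine val_eq ⟨r.nonneg a, ⟨1, by rw [one_nsmul]; exact r.v_le a⟩, fun i => ?_⟩
  have := r.clip_split (p := 0) (r.nonneg a) (r.v_le a) i
  rw [zero_nsmul, zero_add] at this
  rw [this]
  simp only [single]
  split_ifs <;> simp_all [r.v_zero]

theorem val_zero (r : ChainRep M) : val r (0 : GoodSeq M) = 0 :=
  (val_single r zero).trans r.v_zero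

/-- The product order of `M^ℕ`, restricted to good sequences. -/
instance : LE (GoodSeq M) := ⟨fun a b => ∀ i, le (a.seq i) (b.seq i)⟩

theorem le_def {a b : GoodSeq M} : a ≤ b ↔ ∀ i, le (a.seq i) (b.seq i) := Iff.rfl

theorem le_iff_val {a b : GoodSeq M} : a ≤ b ↔ ∀ r : ChainRep M, val r a ≤ val r b := by
  constructor
  · intro h r
    exact ((val_spec r a).le_iff (val_spec r b)).2 fun i => rep_le r (h i)
  · intro h i
    exact le_of_rep fun r => ((val_spec r a).le_iff (val_spec r b)).1 (h r) i

instance : PartialOrder (GoodSeq M) where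
  le_refl a i := MVAlgebra.le_refl _
  le_trans a b c h h' i := MVAlgebra.le_trans (h i) (h' i)
  le_antisymm a b h h' := GoodSeq.ext (funext fun i => MVAlgebra.le_antisymm (h i) (h' i))

theorem eq_of_val {a b : GoodSeq M} (h : ∀ r : ChainRep M, val r a = val r b) : a = b :=
  _root_.le_antisymm (le_iff_val.2 fun r => (h r).le) (le_iff_val.2 fun r => (h r).ge)

/-- The commutative monoid of good sequences. -/
instance : AddCommMonoid (GoodSeq M) where
  add_assoc a b c := eq_of_val fun r => by simp only [val_add, add_assoc]
  zero_add a := eq_of_val fun r => by simp only [val_add, val_zero, zero_add]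
  add_zero a := eq_of_val fun r => by simp only [val_add, val_zero, add_zero]
  add_comm a b := eq_of_val fun r => by simp only [val_add, add_comm]
  nsmul := nsmulRec

instance : IsOrderedCancelAddMonoid (GoodSeq M) where
  add_le_add_left a b h c := le_iff_val.2 fun r => by
    rw [val_add, val_add]
    exact add_le_add_left (le_iff_val.1 h r) _
  le_of_add_le_add_left a b c h := le_iff_val.2 fun r => by
    have := le_iff_val.1 h r
    rw [val_add, val_add] at this
    exact le_of_add_le_add_left this

/-- The pointwise join of good sequences. -/
def gsup (a b : GoodSeq M) : GoodSeq M where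
  seq i := MVAlgebra.sup (a.seq i) (b.seq i)
  good := good_of_val fun r => by
    rcases le_total (val r a) (val r b) with h | h
    · refine ⟨val r b, (val_spec r b).nonneg, (val_spec r b).bdd, fun i => ?_⟩
      rw [r.v_sup, max_eq_right (((val_spec r a).le_iff (val_spec r b)).1 h i), (val_spec r b).eq]
    · refine ⟨val r a, (val_spec r a).nonneg, (val_spec r a).bdd, fun i => ?_⟩
      rw [r.v_sup, max_eq_left (((val_spec r b).le_iff (val_spec r a)).1 h i), (val_spec r a).eq]
  finite := by
    obtain ⟨n, hn⟩ := a.finite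
    obtain ⟨m, hm⟩ := b.finite
    refine ⟨n + m, fun k hk => ?_⟩
    rw [hn k (by omega), hm k (by omega), MVAlgebra.sup, oplus_zero, odot_comm, odot_zero]

theorem val_gsup (r : ChainRep M) (a b : GoodSeq M) :
    val r (gsup a b) = max (val r a) (val r b) := by
  rcases le_total (val r a) (val r b) with h | h
  · rw [max_eq_right h]
    refine val_eq ⟨(val_spec r b).nonneg, (val_spec r b).bdd, fun i => ?_⟩
    change r.v (MVAlgebra.sup _ _) = _
    rw [r.v_sup, max_eq_right (((val_spec r a).le_iff (val_spec r b)).1 h i), (val_spec r b).eq]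
  · rw [max_eq_left h]
    refine val_eq ⟨(val_spec r a).nonneg, (val_spec r a).bdd, fun i => ?_⟩
    change r.v (MVAlgebra.sup _ _) = _
    rw [r.v_sup, max_eq_left (((val_spec r b).le_iff (val_spec r a)).1 h i), (val_spec r a).eq]

theorem gsup_add (a b c : GoodSeq M) : gsup a b + c = gsup (a + c) (b + c) :=
  eq_of_val fun r => by simp only [val_add, val_gsup, max_add_add_right]

theorem isLUB_gsup (a b : GoodSeq M) : IsLUB {a, b} (gsup a b) := by
  constructor
  · rintro c (rfl | rfl) <;> exact le_iff_val.2 fun r => by rw [val_gsup]; simp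
  · intro c hc
    have h1 := hc (Set.mem_insert a {b})
    have h2 := hc (Set.mem_insert_of_mem a rfl)
    exact le_iff_val.2 fun r => by
      rw [val_gsup]; exact max_le (le_iff_val.1 h1 r) (le_iff_val.1 h2 r)

/-- Truncation of a sequence to its first `n` terms. -/
def trunc (a : GoodSeq M) (n : ℕ) : GoodSeq M where
  seq i := if i < n then a.seq i else zero
  good i := by
    by_cases h : i + 1 < n
    · rw [if_pos h, if_pos (by omega), a.good]
    · rw [if_neg h, oplus_zero]
  finite := ⟨n, fun k hk => if_neg (by omega)⟩

theorem seqAdd_single_zero (a : GoodSeq M) (b : M) :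
    (a + single b).seq 0 = a.seq 0 ⊕ₘ b := by
  change a.seq 0 ⊕ₘ zero ⊕ₘ b = _
  rw [oplus_zero]

theorem seqAdd_single_succ (a : GoodSeq M) (b : M) (k : ℕ) :
    (a + single b).seq (k + 1) = a.seq (k + 1) ⊕ₘ (a.seq k ⊙ₘ b) := by
  have key : ∀ n, n ≤ k → bigOplus (fun j => a.seq (k + 1 - 1 - j) ⊙ₘ (single b).seq j) (n + 1)
      = a.seq k ⊙ₘ b := by
    intro n hn
    induction n with
    | zero => exact zero_oplus _
    | succ n ih =>
      rw [bigOplus, ih (by omega)]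
      change _ ⊕ₘ (_ ⊙ₘ zero) = _
      rw [odot_zero, oplus_zero]
  change a.seq (k + 1) ⊕ₘ bigOplus _ (k + 1) ⊕ₘ zero = _
  rw [key k le_rfl, oplus_zero]

theorem trunc_succ (a : GoodSeq M) (n : ℕ) :
    a.trunc (n + 1) = a.trunc n + single (a.seq n) := by
  have habs : ∀ i, i < n → a.seq i ⊕ₘ a.seq n = a.seq i := by
    intro i hi
    refine eq_of_rep fun r => ?_
    obtain ⟨x, hx⟩ := r.exists_val a
    have he := r.e_nonneg
    have := r.succ_nsmul_le _ _ hi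
    rw [r.v_oplus, hx.eq, hx.eq, ChainRep.clip, ChainRep.clip]
    grind
  ext i
  cases i with
  | zero =>
    rw [seqAdd_single_zero]
    simp only [trunc]
    rcases Nat.eq_zero_or_pos n with rfl | hn
    · simp [zero_oplus]
    · simp [hn, habs 0 hn]
  | succ i =>
    rw [seqAdd_single_succ]
    simp only [trunc]
    rcases Nat.lt_trichotomy (i + 1) n with h | h | h
    · rw [if_pos (by omega), if_pos h, if_pos (by omega)]
      refine MVAlgebra.le_antisymm (le_oplus_left _ _) ?_
      have := oplus_le (MVAlgebra.le_refl (a.seq (i + 1))) (odot_le_right (a.seq i) (a.seq n))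
      rwa [habs _ h] at this
    · subst h
      rw [if_pos (by omega), if_neg (by omega), if_pos (by omega), zero_oplus]
      refine eq_of_rep fun r => ?_
      have h1 := congrArg r.v (a.good i)
      have h2 := r.nonneg (a.seq (i + 1))
      have h3 := r.v_le (a.seq (i + 1))
      rw [r.v_oplus] at h1
      rw [r.v_odot]
      grind
    · rw [if_neg (by omega), if_neg (by omega), if_neg (by omega), odot_comm, odot_zero,
        oplus_zero]

theorem trunc_eq_sum (a : GoodSeq M) (n : ℕ) :
    a.trunc n = ∑ i ∈ Finset.range n, single (a.seq i) := by
  induction n with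
  | zero => ext i; exact (zero_seq i).symm
  | succ n ih => rw [trunc_succ, ih, Finset.sum_range_succ]

theorem eq_sum (a : GoodSeq M) {n : ℕ} (hn : ∀ k, n ≤ k → a.seq k = zero) :
    a = ∑ i ∈ Finset.range n, single (a.seq i) := by
  rw [← trunc_eq_sum]
  ext i
  simp only [trunc]
  split_ifs with h
  · rfl
  · exact hn i (by omega)

end GoodSeq
end MVAlgebra

namespace MVAlgebra
variable {M : Type u} [MVAlgebra M]

/-! ### The group `Ξ M` -/

/-- The Abelian group `Ξ M` of classes `[a, b]` of pairs of good sequences, i.e. the universal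
group of the monoid of good sequences. It is ordered by `[a, b] ≤ [c, d]` iff `d + a ≤ b + c`. -/
abbrev XiGroup (M : Type u) [MVAlgebra M] : Type u := Algebra.GrothendieckAddGroup (GoodSeq M)

namespace XiGroup

/-- The class `[a, b]`. -/
def mk (a b : GoodSeq M) : XiGroup M := AddLocalization.mk a ⟨b, AddSubmonoid.mem_top b⟩

theorem exists_mk (x : XiGroup M) : ∃ a b, x = mk a b :=
  AddLocalization.induction_on x fun y => ⟨y.1, y.2.1, rfl⟩

theorem mk_le_mk {a b c d : GoodSeq M} : mk a b ≤ mk c d ↔ d + a ≤ b + c :=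
  AddLocalization.mk_le_mk

theorem mk_add_mk (a b c d : GoodSeq M) : mk a b + mk c d = mk (a + c) (b + d) :=
  AddLocalization.mk_add _ _ _ _

theorem neg_mk (a b : GoodSeq M) : -mk a b = mk b a :=
  Algebra.GrothendieckAddGroup.neg_mk _ _

theorem zero_eq : (0 : XiGroup M) = mk 0 0 := AddLocalization.mk_zero.symm

theorem mk_eq_mk {a b c d : GoodSeq M} : mk a b = mk c d ↔ a + d = c + b := by
  constructor
  · intro h
    have h1 := mk_le_mk.1 h.le
    have h2 := mk_le_mk.1 h.ge
    rw [add_comm a, add_comm c]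
    exact _root_.le_antisymm h1 h2
  · intro h
    rw [add_comm a, add_comm c] at h
    exact _root_.le_antisymm (mk_le_mk.2 h.le) (mk_le_mk.2 h.ge)

theorem isLUB_mk (a b c d : GoodSeq M) :
    IsLUB {mk a b, mk c d} (mk (GoodSeq.gsup (a + d) (c + b)) (b + d)) := by
  have hs := GoodSeq.isLUB_gsup (a + d) (c + b)
  have hl := hs.1 (Set.mem_insert _ _)
  have hr := hs.1 (Set.mem_insert_of_mem _ rfl)
  constructor
  · rintro x (rfl | rfl)
    · rw [mk_le_mk, show b + d + a = b + (a + d) by abel]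
      gcongr
    · rw [mk_le_mk, show b + d + c = d + (c + b) by abel]
      gcongr
  · intro x
    obtain ⟨e, f, rfl⟩ := exists_mk x
    intro hx
    have h1 := mk_le_mk.1 (hx (Set.mem_insert _ _))
    have h2 := mk_le_mk.1 (hx (Set.mem_insert_of_mem _ rfl))
    rw [mk_le_mk, add_comm f, GoodSeq.gsup_add]
    refine (GoodSeq.isLUB_gsup _ _).2 ?_
    rintro y (rfl | rfl)
    · rw [show a + d + f = d + (f + a) by abel, show b + d + e = d + (b + e) by abel]
      gcongr
    · rw [show c + b + f = b + (f + c) by abel, show b + d + e = b + (d + e) by abel]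
      gcongr

theorem exists_isLUB (x y : XiGroup M) : ∃ z, IsLUB {x, y} z := by
  obtain ⟨a, b, rfl⟩ := exists_mk x
  obtain ⟨c, d, rfl⟩ := exists_mk y
  exact ⟨_, isLUB_mk a b c d⟩

/-- The translation-invariant order of `Ξ M` is a lattice order. -/
noncomputable instance : Lattice (XiGroup M) where
  sup x y := (exists_isLUB x y).choose
  inf x y := -(exists_isLUB (-x) (-y)).choose
  le_sup_left x y := (exists_isLUB x y).choose_spec.1 (Set.mem_insert _ _)
  le_sup_right x y := (exists_isLUB x y).choose_spec.1 (Set.mem_insert_of_mem _ rfl)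
  sup_le x y z h h' := (exists_isLUB x y).choose_spec.2 (by rintro w (rfl | rfl) <;> assumption)
  inf_le_left x y := neg_le_of_neg_le
    ((exists_isLUB (-x) (-y)).choose_spec.1 (Set.mem_insert _ _))
  inf_le_right x y := neg_le_of_neg_le
    ((exists_isLUB (-x) (-y)).choose_spec.1 (Set.mem_insert_of_mem _ rfl))
  le_inf x y z h h' := le_neg_of_le_neg ((exists_isLUB (-y) (-z)).choose_spec.2 (by
    rintro w (rfl | rfl) <;> exact neg_le_neg (by assumption)))

theorem mk_sup_mk (a b c d : GoodSeq M) :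
    mk a b ⊔ mk c d = mk (GoodSeq.gsup (a + d) (c + b)) (b + d) :=
  (isLUB_mk a b c d).unique isLUB_pair |>.symm

/-- The canonical map `φ : M → Ξ M`, `a ↦ [(a), (0)]`. -/
def phi (a : M) : XiGroup M := mk (GoodSeq.single a) 0

theorem phi_mono {a b : M} (h : le a b) : phi a ≤ phi b := by
  rw [phi, phi, mk_le_mk, zero_add, zero_add]
  intro i
  simp only [GoodSeq.single]
  split_ifs
  · exact h
  · exact MVAlgebra.le_refl _

theorem phi_zero : phi (zero : M) = 0 := zero_eq.symm

theorem phi_nonneg (a : M) : 0 ≤ phi a := by rw [← phi_zero]; exact phi_mono (zero_le a)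

theorem phi_add {a b : M} (h : a ⊙ₘ b = zero) : phi (a ⊕ₘ b) = phi a + phi b := by
  rw [phi, phi, phi, mk_add_mk, add_zero]
  congr 1
  refine GoodSeq.eq_of_val fun r => ?_
  have h1 := congrArg r.v h
  rw [r.v_odot, r.v_zero] at h1
  rw [GoodSeq.val_add, GoodSeq.val_single, GoodSeq.val_single, GoodSeq.val_single, r.v_oplus]
  grind

theorem mk_eq_sub (a b : GoodSeq M) : mk a b = mk a 0 - mk b 0 := by
  rw [sub_eq_add_neg, neg_mk, mk_add_mk, add_zero, zero_add]

/-- The unit `η` of the universal group. -/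
def eta : GoodSeq M →+ XiGroup M where
  toFun a := mk a 0
  map_zero' := zero_eq.symm
  map_add' a b := by rw [mk_add_mk, add_zero]

theorem eta_eq_sum (a : GoodSeq M) {n : ℕ} (hn : ∀ k, n ≤ k → a.seq k = zero) :
    mk a 0 = ∑ i ∈ Finset.range n, phi (a.seq i) := by
  change eta a = _
  rw [a.eq_sum hn, map_sum]
  refine Finset.sum_congr rfl fun i _ => ?_
  rw [← a.eq_sum hn]; rfl

theorem strong_unit (x : XiGroup M) : ∃ n : ℕ, x ≤ n • phi one := by
  obtain ⟨a, b, rfl⟩ := exists_mk x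
  obtain ⟨n, hn⟩ := a.finite
  refine ⟨n, ?_⟩
  have hb : (0 : XiGroup M) ≤ mk b 0 := by
    rw [zero_eq, mk_le_mk, add_zero, zero_add]
    intro i
    rw [GoodSeq.zero_seq]; exact zero_le _
  rw [mk_eq_sub]
  refine (sub_le_self _ hb).trans ?_
  rw [eta_eq_sum a hn]
  have := Finset.sum_le_card_nsmul (Finset.range n) (fun i => phi (a.seq i)) (phi one)
    (fun i _ => phi_mono (le_one _))
  rwa [Finset.card_range] at this

/-- A homomorphism on `Ξ M` is determined by its restriction to `M`. -/
theorem hom_ext {A : Type*} [AddCommGroup A] {f g : XiGroup M →+ A}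
    (h : ∀ a : M, f (phi a) = g (phi a)) : f = g := by
  have key : ∀ a : GoodSeq M, f (mk a 0) = g (mk a 0) := by
    intro a
    obtain ⟨n, hn⟩ := a.finite
    rw [eta_eq_sum a hn, map_sum, map_sum]
    exact Finset.sum_congr rfl fun i _ => h _
  ext x
  obtain ⟨a, b, rfl⟩ := exists_mk x
  rw [mk_eq_sub, map_sub, map_sub, key, key]

/-- The homomorphism `[a, b] ↦ F a - F b` induced by a monoid homomorphism `F`. -/
noncomputable def lift {A : Type u} [AddCommGroup A] (F : GoodSeq M →+ A) : XiGroup M →+ A :=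
  Algebra.GrothendieckAddGroup.lift F

theorem lift_eta {A : Type u} [AddCommGroup A] (F : GoodSeq M →+ A) (a : GoodSeq M) :
    lift F (mk a 0) = F a :=
  DFunLike.congr_fun (Algebra.GrothendieckAddGroup.lift.symm_apply_apply F) a

theorem lift_mk {A : Type u} [AddCommGroup A] (F : GoodSeq M →+ A) (a b : GoodSeq M) :
    lift F (mk a b) = F a - F b := by
  rw [mk_eq_sub, map_sub, lift_eta, lift_eta]

/-! ### Extension of additive maps from `M` to `Ξ M` -/

section Extend
variable {A : Type u} [AddCommGroup A] (f : M → A)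

/-- Additivity: `f(a ⊕ b) = f(a) + f(b)` whenever `a ⊙ b = 0`. -/
def IsAdditive : Prop := ∀ a b : M, a ⊙ₘ b = zero → f (a ⊕ₘ b) = f a + f b

theorem additive_zero (hf : IsAdditive f) : f zero = 0 := by
  have := hf zero zero (odot_zero _)
  rw [oplus_zero] at this
  exact left_eq_add.1 this

theorem additive_val (hf : IsAdditive f) (a b : M) : f a + f b = f (a ⊕ₘ b) + f (a ⊙ₘ b) := by
  have e1 : f (a ⊕ₘ b) = f a + f (inf b (¬ₘ a)) := by
    rw [← hf]
    · congr 1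
      refine eq_of_rep fun r => ?_
      have := r.nonneg a
      have := r.nonneg b
      have := r.v_le a
      rw [r.v_oplus, r.v_oplus, r.v_inf, r.v_neg]
      grind
    · refine eq_of_rep fun r => ?_
      rw [r.v_odot, r.v_inf, r.v_neg, r.v_zero]
      grind
  have e2 : f b = f (inf b (¬ₘ a)) + f (a ⊙ₘ b) := by
    rw [← hf]
    · congr 1
      refine eq_of_rep fun r => ?_
      have := r.v_le b
      rw [r.v_oplus, r.v_odot, r.v_inf, r.v_neg]
      grind
    · refine eq_of_rep fun r => ?_
      have := r.v_le a
      have := r.v_le b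
      rw [r.v_odot, r.v_odot, r.v_inf, r.v_neg, r.v_zero]
      grind
  rw [e1, e2]; abel

/-- `∑ᵢ f(aᵢ)` over the terms of a good sequence. -/
noncomputable def sumSeq (a : GoodSeq M) : A := ∑ i ∈ Finset.range a.finite.choose, f (a.seq i)

theorem sumSeq_eq (hf : IsAdditive f) (a : GoodSeq M) {n : ℕ} (hn : ∀ k, n ≤ k → a.seq k = zero) :
    sumSeq f a = ∑ i ∈ Finset.range n, f (a.seq i) := by
  have key : ∀ m l : ℕ, m ≤ l → (∀ k, m ≤ k → a.seq k = zero) →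
      ∑ i ∈ Finset.range m, f (a.seq i) = ∑ i ∈ Finset.range l, f (a.seq i) := by
    intro m l hml hm
    refine Finset.sum_subset (Finset.range_mono hml) fun i _ hi => ?_
    rw [hm i (by simpa using hi), additive_zero f hf]
  rcases le_total n a.finite.choose with h | h
  · exact (key _ _ h hn).symm
  · exact key _ _ h a.finite.choose_spec

theorem sumSeq_single (hf : IsAdditive f) (b : M) : sumSeq f (GoodSeq.single b) = f b := by
  rw [sumSeq_eq f hf (GoodSeq.single b) (n := 1) fun k hk => by
    simp [GoodSeq.single, show k ≠ 0 by omega]]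
  simp [GoodSeq.single]

theorem sumSeq_add_single (hf : IsAdditive f) (a : GoodSeq M) (b : M) :
    sumSeq f (a + GoodSeq.single b) = sumSeq f a + f b := by
  obtain ⟨n, hn⟩ := a.finite
  rw [sumSeq_eq f hf a (n := n + 1) fun k hk => hn k (by omega),
    sumSeq_eq f hf (a + GoodSeq.single b) (n := n + 1) fun k hk => by
      obtain ⟨k, rfl⟩ : ∃ l, k = l + 1 := ⟨k - 1, by omega⟩
      rw [GoodSeq.seqAdd_single_succ, hn (k + 1) (by omega), hn k (by omega), odot_comm,
        odot_zero, oplus_zero]]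
  have key : ∀ m, ∑ i ∈ Finset.range (m + 1), f ((a + GoodSeq.single b).seq i)
      = ∑ i ∈ Finset.range (m + 1), f (a.seq i) + f b - f (a.seq m ⊙ₘ b) := by
    intro m
    induction m with
    | zero =>
      simp only [zero_add, Finset.sum_range_one, GoodSeq.seqAdd_single_zero]
      rw [additive_val f hf]; abel
    | succ m ih =>
      rw [Finset.sum_range_succ, ih, Finset.sum_range_succ _ (m + 1), GoodSeq.seqAdd_single_succ]
      have h1 := additive_val f hf (a.seq (m + 1)) (a.seq m ⊙ₘ b)
      have h2 : a.seq (m + 1) ⊙ₘ (a.seq m ⊙ₘ b) = a.seq (m + 1) ⊙ₘ b := by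
        refine eq_of_rep fun r => ?_
        have g1 := congrArg r.v (a.good m)
        have g2 := r.nonneg (a.seq (m + 1))
        have g3 := r.v_le (a.seq (m + 1))
        have g4 := r.v_le b
        have g5 := r.v_le (a.seq m)
        rw [r.v_oplus] at g1
        rw [r.v_odot, r.v_odot, r.v_odot]
        grind
      rw [h2] at h1
      rw [eq_sub_of_add_eq h1.symm]; abel
  rw [key, hn n le_rfl, odot_comm, odot_zero, additive_zero f hf, sub_zero]

theorem sumSeq_zero (hf : IsAdditive f) : sumSeq f (0 : GoodSeq M) = 0 :=
  (sumSeq_single f hf zero).trans (additive_zero f hf)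

theorem sumSeq_add (hf : IsAdditive f) (a b : GoodSeq M) : sumSeq f (a + b) = sumSeq f a + sumSeq f b := by
  obtain ⟨n, hn⟩ := b.finite
  have key : ∀ m, sumSeq f (a + ∑ i ∈ Finset.range m, GoodSeq.single (b.seq i))
      = sumSeq f a + ∑ i ∈ Finset.range m, f (b.seq i) := by
    intro m
    induction m with
    | zero => simp
    | succ m ih =>
      rw [Finset.sum_range_succ, ← add_assoc, sumSeq_add_single f hf, ih, Finset.sum_range_succ,
        add_assoc]
  rw [sumSeq_eq f hf b hn, ← key n, ← b.eq_sum hn]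

/-- The extension of `f` to `Ξ M`: `[a, b] ↦ ∑ᵢ f(aᵢ) - ∑ᵢ f(bᵢ)`. -/
noncomputable def extend (hf : IsAdditive f) : XiGroup M →+ A :=
  lift { toFun := sumSeq f, map_zero' := sumSeq_zero f hf, map_add' := sumSeq_add f hf }

theorem extend_phi (hf : IsAdditive f) (a : M) : extend f hf (phi a) = f a :=
  (lift_eta _ _).trans (sumSeq_single f hf a)

theorem extend_mk (hf : IsAdditive f) (a b : GoodSeq M) : extend f hf (mk a b) = sumSeq f a - sumSeq f b :=
  lift_mk _ a b

theorem extend_nonneg (hf : IsAdditive f) [PartialOrder A] [IsOrderedAddMonoid A]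
    (hmono : ∀ a b : M, le a b → f a ≤ f b) (x : XiGroup M) (hx : 0 ≤ x) :
    0 ≤ extend f hf x := by
  obtain ⟨a, b, rfl⟩ := exists_mk x
  rw [zero_eq, mk_le_mk, add_zero, zero_add] at hx
  rw [extend_mk, sub_nonneg]
  obtain ⟨n, hn⟩ := a.finite
  obtain ⟨m, hm⟩ := b.finite
  rw [sumSeq_eq f hf a (n := n + m) fun k hk => hn k (by omega),
    sumSeq_eq f hf b (n := n + m) fun k hk => hm k (by omega)]
  exact Finset.sum_le_sum fun i _ => hmono _ _ (hx i)

end Extend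
end XiGroup
end MVAlgebra

/-! ### Homomorphisms of MV-algebras, unital Abelian ℓ-groups, states -/

/-- Homomorphisms of MV-algebras. -/
@[ext] structure MVHom (M N : Type u) [MVAlgebra M] [MVAlgebra N] where
  toFun : M → N
  map_oplus : ∀ a b, toFun (a ⊕ₘ b) = toFun a ⊕ₘ toFun b
  map_neg : ∀ a, toFun (¬ₘ a) = ¬ₘ (toFun a)
  map_zero : toFun MVAlgebra.zero = MVAlgebra.zero

/-- Unital Abelian ℓ-groups: lattice-ordered Abelian groups with a strong order unit. -/
structure UnitalLGroup where
  carrier : Type u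
  [grp : AddCommGroup carrier]
  [lat : Lattice carrier]
  [ordered : IsOrderedAddMonoid carrier]
  unit : carrier
  unit_nonneg : 0 ≤ unit
  strong : ∀ g : carrier, ∃ n : ℕ, g ≤ n • unit

attribute [instance] UnitalLGroup.grp UnitalLGroup.lat UnitalLGroup.ordered

/-- Unital ℓ-homomorphisms. -/
@[ext] structure UnitalLHom (G H : UnitalLGroup.{u}) where
  toHom : G.carrier →+ H.carrier
  map_sup : ∀ a b, toHom (a ⊔ b) = toHom a ⊔ toHom b
  map_inf : ∀ a b, toHom (a ⊓ b) = toHom a ⊓ toHom b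
  map_unit : toHom G.unit = H.unit

/-- States between unital Abelian ℓ-groups: positive unit-preserving group homomorphisms. -/
@[ext] structure LState (G H : UnitalLGroup.{u}) where
  toHom : G.carrier →+ H.carrier
  pos : ∀ g, 0 ≤ g → 0 ≤ toHom g
  map_unit : toHom G.unit = H.unit

/-! ### The functor `Γ` -/

/-- The unit interval `{a ∈ G ∣ 0 ≤ a ≤ 1}`. -/
@[ext] structure Gam (G : UnitalLGroup.{u}) : Type u where
  val : G.carrier
  nonneg : 0 ≤ val
  le_unit : val ≤ G.unit

namespace Gam
variable {G H K : UnitalLGroup.{u}}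

/-- The unit interval with `a ⊕ b = (a + b) ∧ 1` and `¬a = 1 - a`. -/
instance : MVAlgebra (Gam G) where
  oplus a b := ⟨(a.val + b.val) ⊓ G.unit, le_inf (add_nonneg a.nonneg b.nonneg) G.unit_nonneg,
    inf_le_right⟩
  neg a := ⟨G.unit - a.val, sub_nonneg.2 a.le_unit, sub_le_self _ a.nonneg⟩
  zero := ⟨0, le_rfl, G.unit_nonneg⟩
  oplus_assoc a b c := by
    have key : ∀ x y z : G.carrier, 0 ≤ z →
        ((x + y) ⊓ G.unit + z) ⊓ G.unit = (x + y + z) ⊓ G.unit := by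
      intro x y z hz
      rw [inf_add, inf_assoc, inf_eq_right.2 (le_add_of_nonneg_right hz)]
    ext
    change ((a.val + b.val) ⊓ G.unit + c.val) ⊓ G.unit
      = (a.val + (b.val + c.val) ⊓ G.unit) ⊓ G.unit
    rw [key _ _ _ c.nonneg, add_comm a.val ((b.val + c.val) ⊓ G.unit), key _ _ _ a.nonneg]
    congr 1; abel
  oplus_comm a b := by
    ext; change (a.val + b.val) ⊓ G.unit = (b.val + a.val) ⊓ G.unit
    rw [add_comm]
  oplus_zero a := by
    ext; change (a.val + 0) ⊓ G.unit = a.val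
    rw [add_zero, inf_eq_left.2 a.le_unit]
  neg_neg a := by
    ext; change G.unit - (G.unit - a.val) = a.val
    abel
  oplus_neg_zero a := by
    ext; change (a.val + (G.unit - 0)) ⊓ G.unit = G.unit - 0
    rw [sub_zero, inf_eq_right.2 (le_add_of_nonneg_left a.nonneg)]
  lukasiewicz a b := by
    have key : ∀ x y : Gam G, (G.unit - (G.unit - x.val + y.val) ⊓ G.unit + y.val) ⊓ G.unit
        = x.val ⊔ y.val := by
      intro x y
      have e1 : G.unit - (G.unit - x.val + y.val) ⊓ G.unit + y.val = x.val ⊔ y.val := by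
        rw [sub_eq_add_neg, neg_inf, add_sup, sup_add]
        congr 1 <;> abel
      rw [e1, inf_eq_left.2 (sup_le x.le_unit y.le_unit)]
    ext
    refine (key a b).trans (Eq.trans ?_ (key b a).symm)
    rw [sup_comm]

theorem val_oplus (a b : Gam G) : (a ⊕ₘ b).val = (a.val + b.val) ⊓ G.unit := rfl
theorem val_neg (a : Gam G) : (¬ₘ a).val = G.unit - a.val := rfl
theorem val_zero : (MVAlgebra.zero : Gam G).val = 0 := rfl
theorem val_one : (MVAlgebra.one : Gam G).val = G.unit := sub_zero _

theorem val_inf (a b : Gam G) : (MVAlgebra.inf a b).val = a.val ⊓ b.val := by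
  change G.unit - ((G.unit - a.val) + (G.unit - (G.unit - a.val + b.val) ⊓ G.unit)) ⊓ G.unit = _
  have e : (G.unit - a.val) + (G.unit - (G.unit - a.val + b.val) ⊓ G.unit)
      = G.unit - a.val ⊓ b.val := by
    have : (G.unit - a.val + b.val) ⊓ G.unit = G.unit - a.val + a.val ⊓ b.val := by
      rw [add_inf, inf_comm, sub_add_cancel]
    rw [this]; abel
  rw [e, inf_eq_left.2 (sub_le_self _ (le_inf a.nonneg b.nonneg))]
  abel

/-- The restriction of a unital ℓ-homomorphism to unit intervals. -/
def map (g : UnitalLHom G H) : MVHom (Gam G) (Gam H) where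
  toFun a := ⟨g.toHom a.val,
    by rw [← inf_eq_left, ← map_zero g.toHom, ← g.map_inf, inf_eq_left.2 a.nonneg],
    by rw [← inf_eq_left, ← g.map_unit, ← g.map_inf, inf_eq_left.2 a.le_unit]⟩
  map_oplus a b := by
    ext
    change g.toHom ((a.val + b.val) ⊓ G.unit) = (g.toHom a.val + g.toHom b.val) ⊓ H.unit
    rw [g.map_inf, map_add, g.map_unit]
  map_neg a := by
    ext
    change g.toHom (G.unit - a.val) = H.unit - g.toHom a.val
    rw [map_sub, g.map_unit]
  map_zero := by
    ext; exact map_zero g.toHom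

/-- The restriction of a state to unit intervals. -/
def restrict (s : LState G H) (a : Gam G) : Gam H :=
  ⟨s.toHom a.val, s.pos _ a.nonneg, by
    have := s.pos _ (sub_nonneg.2 a.le_unit)
    rwa [map_sub, s.map_unit, sub_nonneg] at this⟩

end Gam

/-! ### The functor `Ξ` -/

/-- The unital Abelian ℓ-group `Ξ M`, with unit `[(1), (0)]`. -/
noncomputable def Xi (M : Type u) [MVAlgebra M] : UnitalLGroup.{u} where
  carrier := MVAlgebra.XiGroup M
  unit := MVAlgebra.XiGroup.phi MVAlgebra.one
  unit_nonneg := MVAlgebra.XiGroup.phi_nonneg _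
  strong := MVAlgebra.XiGroup.strong_unit

namespace Xi
open MVAlgebra
variable {M N : Type u} [MVAlgebra M] [MVAlgebra N]

theorem map_one (h : MVHom M N) : h.toFun one = one := by
  rw [one, h.map_neg, h.map_zero]; rfl

theorem map_odot (h : MVHom M N) (a b : M) : h.toFun (a ⊙ₘ b) = h.toFun a ⊙ₘ h.toFun b := by
  rw [odot, odot, h.map_neg, h.map_oplus, h.map_neg, h.map_neg]

theorem map_bigOplus (h : MVHom M N) (f : ℕ → M) (n : ℕ) :
    h.toFun (bigOplus f n) = bigOplus (fun i => h.toFun (f i)) n := by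
  induction n with
  | zero => exact h.map_zero
  | succ n ih => rw [bigOplus, h.map_oplus, ih, bigOplus]

/-- The map `(aᵢ) ↦ (h(aᵢ))` on good sequences. -/
def starFun (h : MVHom M N) (a : GoodSeq M) : GoodSeq N where
  seq i := h.toFun (a.seq i)
  good i := by rw [← h.map_oplus, a.good]
  finite := by
    obtain ⟨n, hn⟩ := a.finite
    exact ⟨n, fun k hk => by rw [hn k hk, h.map_zero]⟩

/-- The map `(aᵢ) ↦ (h(aᵢ))` as a monoid homomorphism. -/
def star (h : MVHom M N) : GoodSeq M →+ GoodSeq N where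
  toFun := starFun h
  map_zero' := by
    ext i
    change h.toFun ((0 : GoodSeq M).seq i) = _
    rw [GoodSeq.zero_seq, GoodSeq.zero_seq, h.map_zero]
  map_add' a b := by
    ext k
    change h.toFun (seqAdd a.seq b.seq k) = seqAdd (starFun h a).seq (starFun h b).seq k
    simp only [seqAdd, h.map_oplus, map_bigOplus, map_odot, starFun]

/-- The group homomorphism `[a, b] ↦ [h*(a), h*(b)]`. -/
noncomputable def mapHom (h : MVHom M N) : XiGroup M →+ XiGroup N :=
  XiGroup.lift (XiGroup.eta.comp (star h))

theorem mapHom_mk (h : MVHom M N) (a b : GoodSeq M) :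
    mapHom h (XiGroup.mk a b) = XiGroup.mk (star h a) (star h b) := by
  rw [mapHom, XiGroup.lift_mk, XiGroup.mk_eq_sub (star h a)]; rfl

theorem mapHom_phi (h : MVHom M N) (a : M) :
    mapHom h (XiGroup.phi a) = XiGroup.phi (h.toFun a) := by
  rw [XiGroup.phi, mapHom_mk, _root_.map_zero, XiGroup.phi]
  congr 1
  ext i
  change h.toFun (if i = 0 then a else zero) = if i = 0 then h.toFun a else zero
  split_ifs
  · rfl
  · exact h.map_zero

theorem star_gsup (h : MVHom M N) (a b : GoodSeq M) :
    star h (GoodSeq.gsup a b) = GoodSeq.gsup (star h a) (star h b) := by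
  ext i
  change h.toFun (sup (a.seq i) (b.seq i)) = sup (h.toFun (a.seq i)) (h.toFun (b.seq i))
  rw [sup, sup, h.map_oplus, map_odot, h.map_neg]

theorem mapHom_sup (h : MVHom M N) (x y : XiGroup M) :
    mapHom h (x ⊔ y) = mapHom h x ⊔ mapHom h y := by
  obtain ⟨a, b, rfl⟩ := XiGroup.exists_mk x
  obtain ⟨c, d, rfl⟩ := XiGroup.exists_mk y
  rw [XiGroup.mk_sup_mk]
  simp only [mapHom_mk, XiGroup.mk_sup_mk, star_gsup, map_add]

theorem mapHom_inf (h : MVHom M N) (x y : XiGroup M) :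
    mapHom h (x ⊓ y) = mapHom h x ⊓ mapHom h y := by
  have e : ∀ {P : Type u} [MVAlgebra P] (a b : XiGroup P), a ⊓ b = -(-a ⊔ -b) := by
    intro P _ a b
    rw [neg_sup, _root_.neg_neg, _root_.neg_neg]
  rw [e x y, e (mapHom h x), _root_.map_neg, mapHom_sup, _root_.map_neg, _root_.map_neg]

/-- The unital ℓ-homomorphism `Ξ h`. -/
noncomputable def map (h : MVHom M N) : UnitalLHom (Xi M) (Xi N) where
  toHom := mapHom h
  map_sup := mapHom_sup h
  map_inf := mapHom_inf h
  map_unit := by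
    refine (mapHom_phi h one).trans ?_
    rw [map_one]; rfl

end Xi

/-! ### The category `ES` of equational states -/

open CategoryTheory

/-- States as two-sorted algebras `(M, N)`: the sorts are MV-algebras and the operation
`s : M → N` satisfies the equations (A1)–(A3). -/
structure ES where
  M : Type u
  N : Type u
  [mvM : MVAlgebra M]
  [mvN : MVAlgebra N]
  s : M → N
  A1 : ∀ a b : M, s (a ⊕ₘ b) = s a ⊕ₘ s (MVAlgebra.inf b (¬ₘ a))
  A2 : ∀ a : M, s (¬ₘ a) = ¬ₘ (s a)
  A3 : s MVAlgebra.one = MVAlgebra.one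

attribute [instance] ES.mvM ES.mvN

namespace ES
open MVAlgebra

/-- Homomorphisms of two-sorted algebras. -/
@[ext] structure Hom (A B : ES.{u}) where
  m : MVHom A.M B.M
  n : MVHom A.N B.N
  comm : ∀ a, n.toFun (A.s a) = B.s (m.toFun a)

instance : Category ES.{u} where
  Hom := Hom
  id A := ⟨⟨id, fun _ _ => rfl, fun _ => rfl, rfl⟩, ⟨id, fun _ _ => rfl, fun _ => rfl, rfl⟩,
    fun _ => rfl⟩
  comp f g :=
    ⟨⟨g.m.toFun ∘ f.m.toFun,
        fun a b => by simp only [Function.comp, f.m.map_oplus, g.m.map_oplus],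
        fun a => by simp only [Function.comp, f.m.map_neg, g.m.map_neg],
        by simp only [Function.comp, f.m.map_zero, g.m.map_zero]⟩,
      ⟨g.n.toFun ∘ f.n.toFun,
        fun a b => by simp only [Function.comp, f.n.map_oplus, g.n.map_oplus],
        fun a => by simp only [Function.comp, f.n.map_neg, g.n.map_neg],
        by simp only [Function.comp, f.n.map_zero, g.n.map_zero]⟩,
      fun a => by simp only [Function.comp, f.comm, g.comm]⟩

variable (A : ES.{u})

theorem s_mono {a b : A.M} (h : le a b) : le (A.s a) (A.s b) := by
  obtain ⟨c, rfl⟩ := le_iff_exists.1 h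
  rw [A.A1]; exact le_oplus_left _ _

/-- The operation `s` is additive when its values are read in `Ξ N`. -/
theorem additive : XiGroup.IsAdditive fun a => XiGroup.phi (A.s a) := by
  intro a b h
  have hab : le b (¬ₘ a) := odot_eq_zero_iff.1 (by rwa [odot_comm])
  have e1 : MVAlgebra.inf b (¬ₘ a) = b :=
    le_antisymm (inf_le_left _ _) (le_inf (le_refl b) hab)
  change XiGroup.phi (A.s (a ⊕ₘ b)) = _
  rw [A.A1, e1]
  refine XiGroup.phi_add ?_
  rw [odot_comm, odot_eq_zero_iff, ← A.A2]
  exact s_mono A hab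

/-- The state `Ξ s : Ξ M → Ξ N` which extends `s`. -/
noncomputable def xiState : LState (Xi A.M) (Xi A.N) where
  toHom := XiGroup.extend _ A.additive
  pos := XiGroup.extend_nonneg _ A.additive fun _ _ h => XiGroup.phi_mono (s_mono A h)
  map_unit := by
    refine (XiGroup.extend_phi _ A.additive one).trans ?_
    rw [A.A3]; rfl

theorem xiState_phi (a : A.M) :
    A.xiState.toHom (XiGroup.phi a) = XiGroup.phi (A.s a) :=
  XiGroup.extend_phi _ A.additive a

/-- `Ξ s` is the only state that extends `s`. -/
theorem xiState_unique (t : LState (Xi A.M) (Xi A.N))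
    (ht : ∀ a : A.M, t.toHom (XiGroup.phi a) = XiGroup.phi (A.s a)) : t = A.xiState :=
  LState.ext (XiGroup.hom_ext fun a => (ht a).trans (A.xiState_phi a).symm)

end ES

/-! ### The category `SS` of states of unital Abelian ℓ-groups -/

/-- States `s : G → H` of unital Abelian ℓ-groups. -/
structure SS where
  G : UnitalLGroup.{u}
  H : UnitalLGroup.{u}
  s : LState G H

namespace SS

/-- Pairs of unital ℓ-homomorphisms forming a commutative square with the states. -/
@[ext] structure Hom (A B : SS.{u}) where
  g : UnitalLHom A.G B.G
  h : UnitalLHom A.H B.H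
  comm : ∀ a, h.toHom (A.s.toHom a) = B.s.toHom (g.toHom a)

instance : Category SS.{u} where
  Hom := Hom
  id A := ⟨⟨AddMonoidHom.id _, fun _ _ => rfl, fun _ _ => rfl, rfl⟩,
    ⟨AddMonoidHom.id _, fun _ _ => rfl, fun _ _ => rfl, rfl⟩, fun _ => rfl⟩
  comp f g :=
    ⟨⟨g.g.toHom.comp f.g.toHom,
        fun a b => by simp only [AddMonoidHom.comp_apply, f.g.map_sup, g.g.map_sup],
        fun a b => by simp only [AddMonoidHom.comp_apply, f.g.map_inf, g.g.map_inf],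
        by simp only [AddMonoidHom.comp_apply, f.g.map_unit, g.g.map_unit]⟩,
      ⟨g.h.toHom.comp f.h.toHom,
        fun a b => by simp only [AddMonoidHom.comp_apply, f.h.map_sup, g.h.map_sup],
        fun a b => by simp only [AddMonoidHom.comp_apply, f.h.map_inf, g.h.map_inf],
        by simp only [AddMonoidHom.comp_apply, f.h.map_unit, g.h.map_unit]⟩,
      fun a => by simp only [AddMonoidHom.comp_apply, f.comm, g.comm]⟩

end SS

/-! ### The functors `Γ²` and `Ξ²` -/

/-- The functor `Γ²`: restriction of states and of morphisms to unit intervals. -/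
def Gamma2 : SS.{u} ⥤ ES.{u} where
  obj A :=
    { M := Gam A.G
      N := Gam A.H
      s := Gam.restrict A.s
      A1 := fun a b => by
        have e : (a.val + b.val) ⊓ A.G.unit = a.val + b.val ⊓ (A.G.unit - a.val) := by
          rw [add_inf, add_sub_cancel]
        ext
        change A.s.toHom ((a ⊕ₘ b).val)
          = (A.s.toHom a.val + A.s.toHom (MVAlgebra.inf b (¬ₘ a)).val) ⊓ A.H.unit
        rw [← map_add, Gam.val_inf, Gam.val_neg, Gam.val_oplus, ← e]
        exact (inf_eq_left.2 (Gam.restrict A.s (a ⊕ₘ b)).le_unit).symm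
      A2 := fun a => by
        ext
        change A.s.toHom (A.G.unit - a.val) = A.H.unit - A.s.toHom a.val
        rw [map_sub, A.s.map_unit]
      A3 := by
        ext
        change A.s.toHom (MVAlgebra.one : Gam A.G).val = (MVAlgebra.one : Gam A.H).val
        rw [Gam.val_one, Gam.val_one, A.s.map_unit] }
  map f := ⟨Gam.map f.g, Gam.map f.h, fun a => Gam.ext (f.comm a.val)⟩
  map_id _ := rfl
  map_comp _ _ := rfl

/-- The functor `Ξ²`: `(M, N)` goes to the state `Ξ s : Ξ M → Ξ N`, and `(m, n)` to
`(Ξ m, Ξ n)`. -/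
noncomputable def Xi2 : ES.{u} ⥤ SS.{u} where
  obj A := ⟨Xi A.M, Xi A.N, A.xiState⟩
  map {A B} f := ⟨Xi.map f.m, Xi.map f.n, fun x => by
    refine DFunLike.congr_fun (f := (Xi.mapHom f.n).comp A.xiState.toHom)
      (g := B.xiState.toHom.comp (Xi.mapHom f.m)) (MVAlgebra.XiGroup.hom_ext fun a => ?_) x
    change Xi.mapHom f.n (A.xiState.toHom (MVAlgebra.XiGroup.phi a))
      = B.xiState.toHom (Xi.mapHom f.m (MVAlgebra.XiGroup.phi a))
    rw [A.xiState_phi, Xi.mapHom_phi, Xi.mapHom_phi, B.xiState_phi, f.comm]⟩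
  map_id A := SS.Hom.ext
    (UnitalLHom.ext (MVAlgebra.XiGroup.hom_ext fun a => Xi.mapHom_phi _ a))
    (UnitalLHom.ext (MVAlgebra.XiGroup.hom_ext fun a => Xi.mapHom_phi _ a))
  map_comp f g := by
    have key : ∀ {P Q R : Type u} [MVAlgebra P] [MVAlgebra Q] [MVAlgebra R]
        (h : MVHom P Q) (k : MVHom Q R) (l : MVHom P R),
        (∀ a, l.toFun a = k.toFun (h.toFun a)) →
        Xi.mapHom l = (Xi.mapHom k).comp (Xi.mapHom h) := by
      intro P Q R _ _ _ h k l hl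
      refine MVAlgebra.XiGroup.hom_ext fun a => ?_
      rw [AddMonoidHom.comp_apply, Xi.mapHom_phi, Xi.mapHom_phi, Xi.mapHom_phi, hl]
    exact SS.Hom.ext (UnitalLHom.ext (key f.m g.m _ fun _ => rfl))
      (UnitalLHom.ext (key f.n g.n _ fun _ => rfl))

/-! ### The unit: `φ` identifies `M` with the unit interval of `Ξ M` -/

namespace MVAlgebra
variable {M : Type u} [MVAlgebra M]

namespace GoodSeq

/-! A two-sorted algebra and a state are each a pair of objects joined by one map, so the proof
works sort by sort. There are two comparison maps, `a ↦ [(a), (0)]` from `M` to `Γ Ξ M` and "sum the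
terms" from `Ξ Γ G` to `G`. Both are shown to be isomorphisms, and they are then checked to commute
with the states and with morphisms. The second task is light: by `XiGroup.hom_ext` an additive map
on `Ξ M` is determined by its values on the elements `phi a`, and there each required identity
unfolds to a defining property of `Ξ s`, `Ξ h` or the sum map.

For `M → Γ Ξ M`, equations and inequalities between good sequences may be tested in totally ordered
groups (`GoodSeq.eq_of_val`, `GoodSeq.le_iff_val`), where a good sequence amounts to the sum of its
values. An element `[a, b]` of the unit interval satisfies `b ≤ a ≤ b + (1)`. In each chain the
difference of the two sums is the sum of the termwise differences and is at most the unit, so the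
single element `⊕ᵢ (aᵢ ⊙ ¬bᵢ)` represents it (`XiGroup.exists_phi_eq`). Surjectivity then also
identifies the truncated sum `(phi a + phi b) ⊓ phi one` with `phi (a ⊕ b)` (`XiGroup.phi_oplus`).

For `Ξ Γ G → G` no representation of `G` is needed. A good sequence in `Γ G` can be recovered from
its sum `g` by lattice operations: the first term is `g ⊓ 1` and the remaining terms sum to `(g - 1)
⊔ 0`. Both operations are monotone in `g`, so the sum map reflects the order (`le_of_sum_le`,
`Gam.sumHom_nonneg_iff`). The identity `g = g ⊓ 1 + (g - 1) ⊔ 0`, iterated, writes every `g` with `0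
≤ g ≤ n • 1` as a sum of elements of `Γ G`; as the unit is strong, the sum map is onto
(`Gam.sumHom_surjective`). An additive bijection that preserves and reflects the order is an
isomorphism of ℓ-groups. -/

theorem val_eq_sum (r : ChainRep M) (a : GoodSeq M) {n : ℕ} (hn : ∀ k, n ≤ k → a.seq k = zero) :
    val r a = ∑ i ∈ Finset.range n, r.v (a.seq i) := by
  have key : ∀ m, val r (∑ i ∈ Finset.range m, single (a.seq i))
      = ∑ i ∈ Finset.range m, r.v (a.seq i) := by
    intro m
    induction m with
    | zero => simp only [Finset.sum_range_zero, val_zero]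
    | succ m ih => rw [Finset.sum_range_succ, Finset.sum_range_succ, val_add, ih, val_single]
  rw [← key n, ← a.eq_sum hn]

end GoodSeq

namespace XiGroup

theorem mk_nonneg_iff {a b : GoodSeq M} : 0 ≤ mk a b ↔ b ≤ a := by
  rw [zero_eq, mk_le_mk, add_zero, zero_add]

theorem phi_le_iff {a b : M} : phi a ≤ phi b ↔ le a b := by
  refine ⟨fun h => ?_, phi_mono⟩
  rw [phi, phi, mk_le_mk, zero_add, zero_add] at h
  -- Only the leading term carries information: all later terms of `(a)` and `(b)` are zero.
  exact h 0

theorem phi_injective : Function.Injective (phi : M → XiGroup M) := fun _ _ h =>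
  MVAlgebra.le_antisymm (phi_le_iff.1 h.le) (phi_le_iff.1 h.ge)

theorem phi_le_unit (a : M) : phi a ≤ phi one := phi_mono (le_one a)

/-- Since `a ⊙ ¬a = 0`, additivity of `phi` applies to `a ⊕ ¬a = 1`. -/
theorem phi_neg (a : M) : phi (¬ₘ a) = phi one - phi a := by
  rw [eq_sub_iff_add_eq, add_comm, ← phi_add (odot_neg a), oplus_neg]

/-- The elements of `Ξ M` between `0` and the unit come from `M`. -/
theorem exists_phi_eq {x : XiGroup M} (h0 : 0 ≤ x) (h1 : x ≤ phi one) : ∃ c, phi c = x := by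
  obtain ⟨a, b, rfl⟩ := exists_mk x
  rw [mk_nonneg_iff] at h0
  rw [phi, mk_le_mk, zero_add] at h1
  obtain ⟨n, hn⟩ := a.finite
  obtain ⟨m, hm⟩ := b.finite
  -- The witness is the truncated sum of the termwise differences `aᵢ ⊖ bᵢ`. Beyond index `n + m`
  -- both sequences vanish, so no term is lost. It remains to see that `(c) + b = a`, which is
  -- tested in each chain.
  refine ⟨bigOplus (fun i => a.seq i ⊙ₘ ¬ₘ (b.seq i)) (n + m), ?_⟩
  rw [phi, mk_eq_mk, add_zero]
  refine GoodSeq.eq_of_val fun r => ?_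
  -- The truncation at `0` in `⊙` is idle because `b ≤ a` holds term by term.
  have e : ∀ i, r.v (a.seq i ⊙ₘ ¬ₘ (b.seq i)) = r.v (a.seq i) - r.v (b.seq i) := by
    intro i
    have := rep_le r (h0 i)
    rw [r.v_odot, r.v_neg]
    grind
  -- The bound `a ≤ b + (1)` makes the other truncation idle: the total of the differences does not
  -- exceed the unit, so the minimum in `v_bigOplus` is the sum itself.
  have h2 := GoodSeq.le_iff_val.1 h1 r
  rw [GoodSeq.val_add, GoodSeq.val_single, r.v_one] at h2
  rw [GoodSeq.val_add, GoodSeq.val_single, r.v_bigOplus, Finset.sum_congr rfl fun i _ => e i,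
    Finset.sum_sub_distrib, ← a.val_eq_sum r fun k hk => hn k (by omega),
    ← b.val_eq_sum r fun k hk => hm k (by omega),
    min_eq_left (sub_le_iff_le_add'.2 h2), sub_add_cancel]

/-- The meet in `Ξ M` need not be computed. It lies in the unit interval, hence has the form `phi
c`, and the inequality `c ≤ a ⊕ b` can be tested in chains, where `⊕` is the sum truncated at the
unit. -/
theorem phi_oplus (a b : M) : phi (a ⊕ₘ b) = (phi a + phi b) ⊓ phi one := by
  -- The comparison with `phi a + phi b` is one between the good sequences `(c)` and `(a) + (b)`, so
  -- chains decide it.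
  have hval : ∀ c : M, phi c ≤ phi a + phi b ↔ ∀ r : ChainRep M, r.v c ≤ r.v a + r.v b := by
    intro c
    simp only [phi, mk_add_mk, mk_le_mk, add_zero, zero_add, GoodSeq.le_iff_val,
      GoodSeq.val_add, GoodSeq.val_single]
  refine _root_.le_antisymm (_root_.le_inf ((hval _).2 fun r => ?_) (phi_le_unit _)) ?_
  · rw [r.v_oplus]; exact min_le_left _ _
  · obtain ⟨c, hc⟩ := exists_phi_eq (x := (phi a + phi b) ⊓ phi one)
      (_root_.le_inf (add_nonneg (phi_nonneg a) (phi_nonneg b)) (phi_nonneg one))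
      _root_.inf_le_right
    rw [← hc]
    refine phi_mono (le_of_rep fun r => ?_)
    rw [r.v_oplus]
    exact _root_.le_min ((hval c).1 (hc.le.trans _root_.inf_le_left) r) (r.v_le c)

end XiGroup
end MVAlgebra

namespace Xi
open MVAlgebra
variable {M : Type u} [MVAlgebra M]

/-- The isomorphism `M → Γ Ξ M`, `a ↦ [(a), (0)]`. -/
noncomputable def unitHom (M : Type u) [MVAlgebra M] : MVHom M (Gam (Xi M)) where
  toFun a := ⟨XiGroup.phi a, XiGroup.phi_nonneg a, XiGroup.phi_le_unit a⟩
  map_oplus a b := Gam.ext (XiGroup.phi_oplus a b)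
  map_neg a := Gam.ext (XiGroup.phi_neg a)
  map_zero := Gam.ext XiGroup.phi_zero

theorem unitHom_bijective : Function.Bijective (unitHom M).toFun :=
  ⟨fun _ _ h => XiGroup.phi_injective (congrArg Gam.val h), fun x =>
    (XiGroup.exists_phi_eq x.nonneg x.le_unit).imp fun _ h => Gam.ext h⟩

end Xi

/-! ### The counit: good sequences in `Γ G` and the elements of `G` -/

/-! ### Recovering a good sequence from its sum in a lattice-ordered Abelian group -/

section LatticeOrderedGroup
variable {G : Type u} [AddCommGroup G] [Lattice G] [IsOrderedAddMonoid G] {e : G}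

/-- Translation gives `(g - e) ⊔ 0 = g ⊔ e - e`, and `g ⊓ e + g ⊔ e = g + e`. This splits `g` into a
head and a remainder, and is used both to read off good sequences and to build preimages. -/
theorem inf_add_sub_sup_zero (g e : G) : g ⊓ e + (g - e) ⊔ 0 = g := by
  have h := inf_add_sup g e
  have h' : (g - e) ⊔ 0 = g ⊔ e - e := by rw [sup_sub, sub_self]
  rw [h', add_sub_assoc', h, add_sub_cancel_right]

/-- The first term of a good sequence is the truncation of its sum. -/
theorem sum_inf_eq_head {f : ℕ → G} (h0 : ∀ i, 0 ≤ f i)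
    (hf : ∀ i, (f i + f (i + 1)) ⊓ e = f i) (n : ℕ) :
    (∑ i ∈ Finset.range (n + 1), f i) ⊓ e = f 0 := by
  induction n generalizing f with
  | zero =>
    rw [zero_add, Finset.sum_range_one]
    exact inf_eq_left.2 ((hf 0).symm.le.trans inf_le_right)
  | succ n ih =>
    -- The shifted sequence satisfies the same hypotheses, so its truncated sum is its own head `f
    -- 1`.
    have h1 := ih (f := fun i => f (i + 1)) (fun i => h0 _) (fun i => hf _)
    rw [Finset.sum_range_succ', add_comm]
    -- Truncating the tail at `e` beforehand changes nothing, because `e ≤ f 0 + e`. The claim then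
    -- reduces to `(f 0 + f 1) ⊓ e = f 0`.
    have h2 : (f 0 + ∑ i ∈ Finset.range (n + 1), f (i + 1)) ⊓ e
        = (f 0 + (∑ i ∈ Finset.range (n + 1), f (i + 1)) ⊓ e) ⊓ e := by
      rw [add_inf, inf_assoc, inf_eq_right.2 (le_add_of_nonneg_left (h0 0))]
    rw [h2, h1, zero_add, hf]

/-- Splitting the whole sum as in `inf_add_sub_sup_zero` gives `f 0` as the head, so cancelling `f
0` leaves the tail. With `sum_inf_eq_head`, both head and tail become monotone functions of the sum.
-/
theorem sum_tail_eq {f : ℕ → G} (h0 : ∀ i, 0 ≤ f i)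
    (hf : ∀ i, (f i + f (i + 1)) ⊓ e = f i) (n : ℕ) :
    ∑ i ∈ Finset.range n, f (i + 1) = (∑ i ∈ Finset.range (n + 1), f i - e) ⊔ 0 := by
  have h1 := inf_add_sub_sup_zero (∑ i ∈ Finset.range (n + 1), f i) e
  rw [sum_inf_eq_head h0 hf] at h1
  rw [← add_right_inj (f 0), h1, Finset.sum_range_succ', add_comm]

/-- A good sequence is a monotone function of its sum. -/
theorem le_of_sum_le {f g : ℕ → G} (hf0 : ∀ i, 0 ≤ f i) (hg0 : ∀ i, 0 ≤ g i)
    (hf : ∀ i, (f i + f (i + 1)) ⊓ e = f i) (hg : ∀ i, (g i + g (i + 1)) ⊓ e = g i) {n : ℕ}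
    (h : ∑ i ∈ Finset.range n, f i ≤ ∑ i ∈ Finset.range n, g i) {i : ℕ} (hi : i < n) :
    f i ≤ g i := by
  induction n generalizing f g i with
  | zero => omega
  | succ n ih =>
    cases i with
    | zero =>
      rw [← sum_inf_eq_head hf0 hf n, ← sum_inf_eq_head hg0 hg n]
      exact inf_le_inf_right e h
    | succ i =>
      -- The inequality of sums passes to the tails, which are the images of the sums under the
      -- monotone map `x ↦ (x - e) ⊔ 0`.
      refine ih (f := fun i => f (i + 1)) (g := fun i => g (i + 1)) (fun _ => hf0 _)
        (fun _ => hg0 _) (fun _ => hf _) (fun _ => hg _) ?_ (by omega)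
      rw [sum_tail_eq hf0 hf, sum_tail_eq hg0 hg]
      exact sup_le_sup_right (sub_le_sub_right h e) 0

end LatticeOrderedGroup

/-! ### The isomorphism between `Ξ Γ G` and `G` -/

namespace Gam
open MVAlgebra
variable {G H : UnitalLGroup.{u}}

/-- Both orders are determined by binary meets, and by `val_inf` the meet of `Γ G` is that of `G`.
-/
theorem val_le_val {a b : Gam G} : a.val ≤ b.val ↔ le a b := by
  have key : le a b ↔ MVAlgebra.inf a b = a :=
    ⟨fun h => MVAlgebra.le_antisymm (inf_le_left _ _) (le_inf (MVAlgebra.le_refl a) h),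
      fun h => by rw [← h]; exact inf_le_right _ _⟩
  rw [key, Gam.ext_iff, val_inf, inf_eq_left]

/-- The condition `a ⊙ b = 0` says `a ≤ 1 - b`, that is `a + b ≤ 1`, so the truncation in `⊕` is
idle. -/
theorem additive_val : XiGroup.IsAdditive (Gam.val : Gam G → G.carrier) := by
  intro a b h
  rw [odot_eq_zero_iff, ← val_le_val, val_neg, le_sub_iff_add_le] at h
  rw [val_oplus, inf_eq_left.2 h]

/-- The homomorphism `Ξ Γ G → G` which extends the inclusion of `Γ G`. -/
noncomputable def sumHom (G : UnitalLGroup.{u}) : XiGroup (Gam G) →+ G.carrier :=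
  XiGroup.extend Gam.val additive_val

theorem sumHom_phi (a : Gam G) : sumHom G (XiGroup.phi a) = a.val :=
  XiGroup.extend_phi _ additive_val a

/-- The substantial direction says that a good sequence with the larger sum is termwise larger,
which is `le_of_sum_le`. Applied to differences, the equivalence makes the sum map an order
embedding, hence injective. -/
theorem sumHom_nonneg_iff (x : XiGroup (Gam G)) : 0 ≤ sumHom G x ↔ 0 ≤ x := by
  refine ⟨fun h => ?_, XiGroup.extend_nonneg _ additive_val (fun _ _ => val_le_val.2) x⟩
  obtain ⟨a, b, rfl⟩ := XiGroup.exists_mk x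
  rw [XiGroup.mk_nonneg_iff]
  intro i
  obtain ⟨n, hn⟩ := a.finite
  obtain ⟨m, hm⟩ := b.finite
  have good : ∀ (c : GoodSeq (Gam G)) (i : ℕ),
      ((c.seq i).val + (c.seq (i + 1)).val) ⊓ G.unit = (c.seq i).val := fun c i =>
    congrArg Gam.val (c.good i)
  -- The common length `n + m + i + 1` exceeds both supports, so the finite sums are the full ones,
  -- and exceeds the index `i` under comparison.
  rw [sumHom, XiGroup.extend_mk, sub_nonneg,
    XiGroup.sumSeq_eq _ additive_val a (n := n + m + i + 1) fun k hk => hn k (by omega),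
    XiGroup.sumSeq_eq _ additive_val b (n := n + m + i + 1) fun k hk => hm k (by omega)] at h
  exact val_le_val.1 (le_of_sum_le (fun i => (b.seq i).nonneg) (fun i => (a.seq i).nonneg)
    (good b) (good a) h (by omega))

theorem sumHom_le_iff (x y : XiGroup (Gam G)) : sumHom G x ≤ sumHom G y ↔ x ≤ y := by
  rw [← sub_nonneg, ← map_sub, sumHom_nonneg_iff, sub_nonneg]

theorem sumHom_surjective : Function.Surjective (sumHom G) := by
  have key : ∀ (n : ℕ) (g : G.carrier), 0 ≤ g → g ≤ n • G.unit → g ∈ (sumHom G).range := by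
    intro n
    induction n with
    | zero =>
      intro g h0 h1
      rw [zero_nsmul] at h1
      rw [h1.antisymm h0]
      exact zero_mem _
    | succ n ih =>
      intro g h0 h1
      -- The head `g ⊓ 1` is the image of an element of `Γ G`; the remainder `(g - 1) ⊔ 0` is
      -- nonnegative and bounded by `n • 1`, so the induction hypothesis covers it.
      rw [← inf_add_sub_sup_zero g G.unit]
      refine add_mem ⟨XiGroup.phi ⟨g ⊓ G.unit, _root_.le_inf h0 G.unit_nonneg,
        _root_.inf_le_right⟩, sumHom_phi _⟩ (ih _ le_sup_right ?_)
      refine _root_.sup_le ?_ (nsmul_nonneg G.unit_nonneg n)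
      rwa [sub_le_iff_le_add, ← succ_nsmul]
  have hpos : ∀ g : G.carrier, 0 ≤ g → g ∈ (sumHom G).range := fun g h0 =>
    (G.strong g).elim fun n h1 => key n g h0 h1
  intro g
  -- An arbitrary element is the difference of its positive and negative parts, and the range is a
  -- subgroup.
  have := sub_mem (hpos g⁺ (posPart_nonneg g)) (hpos g⁻ (negPart_nonneg g))
  rwa [posPart_sub_negPart] at this

/-- `Ξ Γ G → G` as an isomorphism of ordered sets. -/
noncomputable def sumOrderIso (G : UnitalLGroup.{u}) : XiGroup (Gam G) ≃o G.carrier :=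
  RelIso.ofSurjective (OrderEmbedding.ofMapLEIff (sumHom G) sumHom_le_iff) sumHom_surjective

/-- The isomorphism `Ξ Γ G → G` of unital Abelian ℓ-groups. -/
noncomputable def counitHom (G : UnitalLGroup.{u}) : UnitalLHom (Xi (Gam G)) G where
  toHom := sumHom G
  -- Joins and meets are determined by the order, so an order isomorphism preserves them; no formula
  -- for them in `Ξ Γ G` is needed.
  map_sup := (sumOrderIso G).map_sup
  map_inf := (sumOrderIso G).map_inf
  map_unit := (sumHom_phi _).trans val_one

theorem counitHom_bijective : Function.Bijective (counitHom G).toHom :=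
  (sumOrderIso G).bijective

end Gam

/-! ### Isomorphisms -/

/-- The inverse of a bijective homomorphism of MV-algebras. -/
noncomputable def MVHom.symm {M N : Type u} [MVAlgebra M] [MVAlgebra N] (f : MVHom M N)
    (hf : Function.Bijective f.toFun) : MVHom N M where
  toFun := (Equiv.ofBijective f.toFun hf).symm
  map_oplus a b := hf.1 <| by
    rw [f.map_oplus]; simp only [Equiv.ofBijective_apply_symm_apply]
  map_neg a := hf.1 <| by
    rw [f.map_neg]; simp only [Equiv.ofBijective_apply_symm_apply]
  map_zero := hf.1 <| by
    rw [f.map_zero]; simp only [Equiv.ofBijective_apply_symm_apply]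

/-- The inverse of a bijective unital ℓ-homomorphism. -/
noncomputable def UnitalLHom.symm {G H : UnitalLGroup.{u}} (f : UnitalLHom G H)
    (hf : Function.Bijective f.toHom) : UnitalLHom H G where
  toHom := (AddEquiv.ofBijective f.toHom hf).symm
  map_sup a b := hf.1 <| by
    rw [f.map_sup]
    exact ((AddEquiv.ofBijective f.toHom hf).apply_symm_apply _).trans (congrArg₂ _
      ((AddEquiv.ofBijective f.toHom hf).apply_symm_apply a).symm
      ((AddEquiv.ofBijective f.toHom hf).apply_symm_apply b).symm)
  map_inf a b := hf.1 <| by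
    rw [f.map_inf]
    exact ((AddEquiv.ofBijective f.toHom hf).apply_symm_apply _).trans (congrArg₂ _
      ((AddEquiv.ofBijective f.toHom hf).apply_symm_apply a).symm
      ((AddEquiv.ofBijective f.toHom hf).apply_symm_apply b).symm)
  map_unit := hf.1 <|
    ((AddEquiv.ofBijective f.toHom hf).apply_symm_apply _).trans f.map_unit.symm

/-- The inverse of a bijective homomorphism is again a homomorphism in each sort. Injectivity on the
second sort transfers the commuting square to the inverses. -/
theorem ES.isIso_of_bijective {A B : ES.{u}} (f : A ⟶ B) (hm : Function.Bijective f.m.toFun)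
    (hn : Function.Bijective f.n.toFun) : IsIso f := by
  have em : ∀ b, f.m.toFun ((f.m.symm hm).toFun b) = b :=
    (Equiv.ofBijective _ hm).apply_symm_apply
  have en : ∀ b, f.n.toFun ((f.n.symm hn).toFun b) = b :=
    (Equiv.ofBijective _ hn).apply_symm_apply
  let g : B ⟶ A := ⟨f.m.symm hm, f.n.symm hn, fun b => hn.1 <| by rw [en, f.comm, em]⟩
  exact ⟨g, ES.Hom.ext (MVHom.ext (funext fun a => hm.1 (em _)))
      (MVHom.ext (funext fun a => hn.1 (en _))),
    ES.Hom.ext (MVHom.ext (funext em)) (MVHom.ext (funext en))⟩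

/-- Positivity is a condition on the states and not on morphisms between them, so bijectivity in
both components suffices, as for algebras. -/
theorem SS.isIso_of_bijective {A B : SS.{u}} (f : A ⟶ B) (hg : Function.Bijective f.g.toHom)
    (hh : Function.Bijective f.h.toHom) : IsIso f := by
  have eg : ∀ b, f.g.toHom ((f.g.symm hg).toHom b) = b :=
    (AddEquiv.ofBijective _ hg).apply_symm_apply
  have eh : ∀ b, f.h.toHom ((f.h.symm hh).toHom b) = b :=
    (AddEquiv.ofBijective _ hh).apply_symm_apply
  let k : B ⟶ A := ⟨f.g.symm hg, f.h.symm hh, fun b => hh.1 <| by rw [eh, f.comm, eg]⟩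
  exact ⟨k, SS.Hom.ext (UnitalLHom.ext (AddMonoidHom.ext fun a => hg.1 (eg _)))
      (UnitalLHom.ext (AddMonoidHom.ext fun a => hh.1 (eh _))),
    SS.Hom.ext (UnitalLHom.ext (AddMonoidHom.ext eg)) (UnitalLHom.ext (AddMonoidHom.ext eh))⟩

/-! ### The equivalence -/

/-- `(M, N) → Γ² Ξ² (M, N)`. -/
noncomputable def esUnit (A : ES.{u}) : A ⟶ (Xi2 ⋙ Gamma2).obj A :=
  -- The square commutes because `Ξ s` extends `s` along `phi`.
  ⟨Xi.unitHom A.M, Xi.unitHom A.N, fun a => Gam.ext (A.xiState_phi a).symm⟩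

/-- `Ξ² Γ² s → s`. -/
noncomputable def ssCounit (A : SS.{u}) : (Gamma2 ⋙ Xi2).obj A ⟶ A :=
  ⟨Gam.counitHom A.G, Gam.counitHom A.H, fun x => by
    -- Both paths of the square are additive on `Ξ Γ G`, so it is enough to compare them at `phi a`,
    -- where each gives `s(a)`.
    refine DFunLike.congr_fun (f := (Gam.sumHom A.H).comp (Gamma2.obj A).xiState.toHom)
      (g := A.s.toHom.comp (Gam.sumHom A.G)) (MVAlgebra.XiGroup.hom_ext fun a => ?_) x
    change Gam.sumHom A.H ((Gamma2.obj A).xiState.toHom (MVAlgebra.XiGroup.phi a))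
      = A.s.toHom (Gam.sumHom A.G (MVAlgebra.XiGroup.phi a))
    rw [ES.xiState_phi]
    exact (Gam.sumHom_phi (Gam.restrict A.s a)).trans
      (congrArg A.s.toHom (Gam.sumHom_phi a)).symm⟩

theorem isIso_esUnit (A : ES.{u}) : IsIso (esUnit A) :=
  ES.isIso_of_bijective _ Xi.unitHom_bijective Xi.unitHom_bijective

theorem isIso_ssCounit (A : SS.{u}) : IsIso (ssCounit A) :=
  SS.isIso_of_bijective _ Gam.counitHom_bijective Gam.counitHom_bijective

/-- Two additive maps on `Ξ Γ G` are compared on the generators `phi a`; both send `phi a` to the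
image of `a` under `f`. This is the naturality of the counit in each component. -/
theorem Gam.sumHom_natural {G H : UnitalLGroup.{u}} (f : UnitalLHom G H) :
    (Gam.sumHom H).comp (Xi.mapHom (Gam.map f)) = f.toHom.comp (Gam.sumHom G) :=
  MVAlgebra.XiGroup.hom_ext fun a => by
    rw [AddMonoidHom.comp_apply, AddMonoidHom.comp_apply, Xi.mapHom_phi, Gam.sumHom_phi,
      Gam.sumHom_phi]
    rfl

/-- The natural isomorphism `Γ² Ξ² ≅ 1`. -/
noncomputable def esIso : Xi2.{u} ⋙ Gamma2.{u} ≅ 𝟭 ES.{u} :=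
  -- The explicit map runs from `A` to `Γ² Ξ² A`, so the natural isomorphism is built in that
  -- direction and inverted; its naturality is `Xi.mapHom_phi` in each sort.
  (NatIso.ofComponents (F := 𝟭 ES) (G := Xi2 ⋙ Gamma2)
    (fun A => @asIso _ _ _ _ (esUnit A) (isIso_esUnit A)) fun {_ _} f => ES.Hom.ext
    (MVHom.ext (funext fun a => Gam.ext (Xi.mapHom_phi f.m a).symm))
    (MVHom.ext (funext fun a => Gam.ext (Xi.mapHom_phi f.n a).symm))).symm

/-- The natural isomorphism `1 ≅ Ξ² Γ²`. -/
noncomputable def ssIso : 𝟭 SS.{u} ≅ Gamma2.{u} ⋙ Xi2.{u} :=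
  (NatIso.ofComponents (F := Gamma2 ⋙ Xi2) (G := 𝟭 SS)
    (fun A => @asIso _ _ _ _ (ssCounit A) (isIso_ssCounit A)) fun {_ _} f => SS.Hom.ext
    (UnitalLHom.ext (Gam.sumHom_natural f.g)) (UnitalLHom.ext (Gam.sumHom_natural f.h))).symm

theorem theorem3p3 :
    ∃ e : SS.{u} ≌ ES.{u}, e.functor = Gamma2.{u} ∧ e.inverse = Xi2.{u} :=
  -- The two isomorphisms need not be checked against the triangle identities: `Equivalence.mk`
  -- adjusts the unit and leaves both functors untouched, hence the two `rfl`.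
  ⟨CategoryTheory.Equivalence.mk Gamma2 Xi2 ssIso esIso, rfl, rfl⟩
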